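/- Let $p$ be a prime number and $n\ge 1$ an integer. Let $\mathcal R_n$ be the ring of virtual ordinary (complex) characters of the symmetric group $\mathfrak S_n$, and let $\bar{\mathcal R}_n=\mathbb F_p\otimes_{\mathbb Z}\mathcal R_n=\mathcal R_n/p\mathcal R_n$. For a partition $\lambda=(\lambda_1\ge\dots\ge\lambda_r)$ of $n$, let $\mathfrak S_\lambda\cong\mathfrak S_{\lambda_1}\times\dots\times\mathfrak S_{\lambda_r}$ be the corresponding standard Young subgroup of $\mathfrak S_n$, let $\varphi_\lambda=\mathrm{Ind}_{\mathfrak S_\lambda}^{\mathfrak S_n}1\in\mathcal R_n$ be the character induced from its trivial character, and let $\bar\varphi_\lambda=1\otimes\varphi_\lambda$ be the image of $\varphi_\lambda$ in $\bar{\mathcal R}_n$. Let $r_k(\lambda)$ be the number of parts of $\lambda$ equal to $k$, and put $\pi_p(\lambda)=\sum_{k=1}^n\lfloor r_k(\lambda)/p\rfloor$. Then, for every integer $i\ge 0$, the $i$-th power of the Jacobson radical of $\bar{\mathcal R}_n$ is $$\bigl(\mathrm{Rad}\,\bar{\mathcal R}_n\bigr)^i=\bigoplus_{\lambda\vdash n,\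 \pi_p(\lambda)\ge i}\mathbb F_p\,\bar\varphi_\lambda ,$$ that is, the elements $\bar\varphi_\lambda$ with $\lambda\vdash n$ and $\pi_p(\lambda)\ge i$ are linearly independent over $\mathbb F_p$ and span $(\mathrm{Rad}\,\bar{\mathcal R}_n)^i$ (where the $0$-th power is $\bar{\mathcal R}_n$ itself). In particular, $\mathrm{Rad}\,\bar{\mathcal R}_n$ is the $\mathbb F_p$-span of the $\bar\varphi_\lambda$ for the $p$-singular partitions $\lambda$ of $n$, i.e. those with some part occurring at least $p$ times. -/

import Mathlib

open scoped TensorProduct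

namespace SymGrothendieck

noncomputable section

/-! ### The ring of virtual characters of a finite group -/

/-- `χ` is the character of a finite-dimensional complex representation of `G`. -/
def IsOrdinaryCharacter {G : Type} [Group G] (χ : G → ℂ) : Prop :=
  ∃ (V : Type) (_ : AddCommGroup V) (_ : Module ℂ V) (_ : FiniteDimensional ℂ V)
    (ρ : Representation ℂ G V), ρ.character = χ

theorem IsOrdinaryCharacter.one {G : Type} [Group G] :
    IsOrdinaryCharacter (1 : G → ℂ) := by
  refine ⟨ℂ, inferInstance, inferInstance, inferInstance, Representation.trivial ℂ G ℂ, ?_⟩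
  funext g
  simp [Representation.character, Representation.trivial]

theorem IsOrdinaryCharacter.mul {G : Type} [Group G] {χ ψ : G → ℂ}
    (hχ : IsOrdinaryCharacter χ) (hψ : IsOrdinaryCharacter ψ) :
    IsOrdinaryCharacter (χ * ψ) := by
  obtain ⟨V, _, _, _, ρ, rfl⟩ := hχ
  obtain ⟨W, _, _, _, σ, rfl⟩ := hψ
  exact ⟨V ⊗[ℂ] W, inferInstance, inferInstance, inferInstance, ρ.tprod σ,
    Representation.char_tensor ρ σ⟩

/-- The ring of virtual ordinary characters of `G`: the additive group generated by the
characters of the finite-dimensional complex representations, with pointwise operations. -/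
def virtualCharacterRing (G : Type) [Group G] : Subring (G → ℂ) where
  toAddSubmonoid :=
    (AddSubgroup.closure {χ : G → ℂ | IsOrdinaryCharacter χ}).toAddSubmonoid
  neg_mem' {x} hx := (AddSubgroup.closure {χ : G → ℂ | IsOrdinaryCharacter χ}).neg_mem hx
  one_mem' := AddSubgroup.subset_closure IsOrdinaryCharacter.one
  mul_mem' {x y} hx hy := by
    change x ∈ AddSubgroup.closure {χ : G → ℂ | IsOrdinaryCharacter χ} at hx
    change y ∈ AddSubgroup.closure {χ : G → ℂ | IsOrdinaryCharacter χ} at hy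
    change x * y ∈ AddSubgroup.closure {χ : G → ℂ | IsOrdinaryCharacter χ}
    induction hx using AddSubgroup.closure_induction with
    | mem χ hχ =>
      induction hy using AddSubgroup.closure_induction with
      | mem ψ hψ => exact AddSubgroup.subset_closure (IsOrdinaryCharacter.mul hχ hψ)
      | zero => rw [mul_zero]; exact AddSubgroup.zero_mem _
      | add a b _ _ ha hb => rw [mul_add]; exact AddSubgroup.add_mem _ ha hb
      | neg a _ ha => rw [mul_neg]; exact AddSubgroup.neg_mem _ ha
    | zero => rw [zero_mul]; exact AddSubgroup.zero_mem _
    | add a b _ _ ha hb => rw [add_mul]; exact AddSubgroup.add_mem _ ha hb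
    | neg a _ ha => rw [neg_mul]; exact AddSubgroup.neg_mem _ ha

theorem mem_virtualCharacterRing_of_isOrdinaryCharacter {G : Type} [Group G] {χ : G → ℂ}
    (hχ : IsOrdinaryCharacter χ) : χ ∈ virtualCharacterRing G :=
  AddSubgroup.subset_closure hχ

/-! ### Induced characters -/

open Classical in
/-- The induced class function: `g ↦ |H|⁻¹ ∑ x, θ°(x⁻¹ g x)`, where `θ°` extends `θ`
by zero outside `H`. -/
def inducedFunction {G : Type} [Group G] [Fintype G] (H : Subgroup G) (θ : H → ℂ) : G → ℂ :=
  fun g => (Nat.card H : ℂ)⁻¹ *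
    ∑ x : G, if h : x⁻¹ * g * x ∈ H then θ ⟨x⁻¹ * g * x, h⟩ else 0

/-- The trivial character of `H`, induced to `G`. -/
def permChar {G : Type} [Group G] [Fintype G] (H : Subgroup G) : G → ℂ :=
  inducedFunction H (fun _ => 1)

open Classical in
theorem character_ofMulAction {G X : Type} [Group G] [MulAction G X] [Fintype X] (g : G) :
    (Representation.ofMulAction ℂ G X).character g = ∑ x : X, if g • x = x then 1 else 0 := by
  rw [Representation.character,
    LinearMap.trace_eq_matrix_trace ℂ (MonoidAlgebra.basis X ℂ), Matrix.trace]
  refine Finset.sum_congr rfl fun x _ => ?_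
  rw [Matrix.diag_apply, LinearMap.toMatrix_apply]
  simp [MonoidAlgebra.basis, Finsupp.single_apply]

open Classical in
theorem permChar_eq_character {G : Type} [Group G] [Fintype G] (H : Subgroup G) :
    (Representation.ofMulAction ℂ G (G ⧸ H)).character = permChar H := by
  funext g
  rw [character_ofMulAction, permChar, inducedFunction]
  have hne : (Nat.card H : ℂ) ≠ 0 := by exact_mod_cast Nat.card_pos.ne'
  rw [eq_inv_mul_iff_mul_eq₀ hne, Finset.mul_sum]
  rw [← Finset.sum_fiberwise (s := Finset.univ) (g := fun x : G => (x : G ⧸ H))]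
  refine Finset.sum_congr rfl fun q _ => ?_
  have key : ∀ x ∈ (Finset.univ.filter fun x : G => (x : G ⧸ H) = q),
      (if _h : x⁻¹ * g * x ∈ H then (1 : ℂ) else 0) = if g • q = q then 1 else 0 := by
    intro x hx
    rw [Finset.mem_filter] at hx
    rw [← hx.2]
    have : (x⁻¹ * g * x ∈ H) ↔ g • (x : G ⧸ H) = (x : G ⧸ H) := by
      rw [MulAction.Quotient.smul_coe, eq_comm, QuotientGroup.eq, smul_eq_mul, mul_assoc]
    by_cases h : x⁻¹ * g * x ∈ H
    · rw [dif_pos h, if_pos (this.1 h)]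
    · rw [dif_neg h, if_neg (fun h2 => h (this.2 h2))]
  rw [Finset.sum_congr rfl key, Finset.sum_const, nsmul_eq_mul]
  congr 2
  induction q using QuotientGroup.induction_on with
  | H a =>
    rw [← Fintype.card_subtype, ← Nat.card_eq_fintype_card]
    refine Nat.card_congr
      { toFun := fun h => ⟨a * h, ?_⟩
        invFun := fun x => ⟨a⁻¹ * x, ?_⟩
        left_inv := fun h => ?_
        right_inv := fun x => ?_ }
    · exact (QuotientGroup.mk_mul_of_mem a h.2)
    · exact QuotientGroup.eq.1 x.2.symm
    · simp
    · simp

theorem permChar_mem {G : Type} [Group G] [Fintype G] (H : Subgroup G) :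
    permChar H ∈ virtualCharacterRing G := by
  classical
  exact mem_virtualCharacterRing_of_isOrdinaryCharacter
    ⟨_, inferInstance, inferInstance, inferInstance,
      Representation.ofMulAction ℂ G (G ⧸ H), permChar_eq_character H⟩

/-! ### Young subgroups -/

/-- The standard Young subgroup of a composition `c = (c₁, …, c_r)` of `n`: the permutations
preserving each of the consecutive blocks of sizes `c₁, …, c_r`. -/
def youngSubgroup {n : ℕ} (c : Composition n) : Subgroup (Equiv.Perm (Fin n)) where
  carrier := {σ | ∀ x, c.index (σ x) = c.index x}
  one_mem' := fun _ => rfl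
  mul_mem' := by
    intro σ τ hσ hτ x
    rw [Equiv.Perm.mul_apply, hσ, hτ]
  inv_mem' := by
    intro σ hσ x
    have h := hσ (σ⁻¹ x)
    have e : σ (σ⁻¹ x) = x := by simp
    rw [e] at h
    exact h.symm

/-- A partition as the composition whose parts are arranged in decreasing order. -/
def toComposition {n : ℕ} (l : n.Partition) : Composition n where
  blocks := l.parts.sort (· ≥ ·)
  blocks_pos := fun h => l.parts_pos ((Multiset.mem_sort _).1 h)
  blocks_sum := by
    rw [← Multiset.sum_coe, Multiset.sort_eq]
    exact l.parts_sum

/-! ### The ring `R_n`, its reduction modulo `p`, and the invariant `π_p` -/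

/-- The ring `R_n` of virtual ordinary characters of the symmetric group of degree `n`. -/
abbrev R (n : ℕ) : Type := virtualCharacterRing (Equiv.Perm (Fin n))

/-- The `F_p`-algebra `F_p ⊗ R_n = R_n / p R_n`. -/
abbrev RBar (p n : ℕ) : Type := ZMod p ⊗[ℤ] R n

/-- The character `φ_λ` of the symmetric group induced from the trivial character of the
Young subgroup of `λ`, as an element of `R_n`. -/
def phi {n : ℕ} (l : n.Partition) : R n :=
  ⟨permChar (youngSubgroup (toComposition l)), permChar_mem _⟩

/-- The image of `φ_λ` in `F_p ⊗ R_n`. -/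
def phiBar (p : ℕ) {n : ℕ} (l : n.Partition) : RBar p n := 1 ⊗ₜ[ℤ] phi l

/-- `π_p(λ) = ∑_{k = 1}^n ⌊r_k(λ) / p⌋`, where `r_k(λ)` is the number of parts equal to `k`. -/
def piP (p : ℕ) {n : ℕ} (l : n.Partition) : ℕ :=
  ∑ k ∈ Finset.Icc 1 n, l.parts.count k / p

/-- A partition is `p`-singular if some part occurs at least `p` times. -/
def IsPSingular (p : ℕ) {n : ℕ} (l : n.Partition) : Prop :=
  ∃ k, p ≤ l.parts.count k

end

end SymGrothendieck

/-!
# Powers of the radical of the character ring of the symmetric group modulo `p`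

The characters `φ_l` count coloured words: `φ_l(g)` is the number of words of length `n` fixed by
`g` in which the letters occur with multiplicities the parts of `l`. Everything below is read off
from this description.

*The `φ_l` are a `ℤ`-basis of `R_n`.* At a permutation of cycle type `m`, the value of `φ_l` is zero
unless `m` refines `l`, and it is `∏ r_k(l)!` if `m = l`. This triangularity gives linear
independence, and, since there are as many conjugacy classes as partitions, the `φ_l` span the
class functions over `ℂ`. For integrality, a virtual character `χ` is sent to the symmetric
polynomial `(1 / n!) ∑ sgn(g) χ(g) p_{type(g)}` in `n` variables. Its coefficients are inner
products of virtual characters, hence integers; it sends `φ_l` to the product `e_l` of elementary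
symmetric polynomials; and it is injective on class functions. The fundamental theorem of
symmetric polynomials then writes `χ` as an integral combination of the `φ_l`
(`span_phi_eq_top`, `phiBarBasis`).

*Products.* `φ_c φ_d` is the sum of `φ_M` over the matrices `M` of natural numbers with row sums
`c` and column sums `d`. If `p` rows, or `p` columns, have equal sums, they can be permuted
cyclically, and modulo `p` only the matrices fixed by all these cyclic permutations matter
(`youngBar_mul_cyclic`). In a fixed matrix the nonzero entries come in groups of `p`, or of `p ^ 2`
where a row cycle meets a column cycle; counting groups shows that the spans `levelSpan p n i` of
the `φ̄_l` with `π_p(l) ≥ i` satisfy `L_1 L_i ⊆ L_{i+1}` (`mul_mem_levelSpan`). In particular `L_1`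
consists of nilpotent elements, so that it lies in the radical. Conversely, evaluation at a
permutation modulo `p` is a homomorphism to a field, so it kills the radical, and triangularity
with diagonal entries `∏ r_k(l)!`, prime to `p` if `π_p(l) = 0`, shows that the radical lies in `L_1`
(`jacobson_le_levelSpan_one`).

*The inclusion `L_i ⊆ Rad ^ i`.* Write the parts of `l` as `g, γ` together with `p` copies of
`k, ρ`, where `g` is at least all members of `γ`. The product of the class of
`(n - pk, k, …, k)` with that of `(g + pk, γ, p·ρ)` is `φ̄_l` plus terms `(γ', p·ρ')` which either have
more members in `ρ'`, or as many with a smaller sum, or the same number and sum with a larger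
greatest member of `γ'`. Induction on these three quantities concludes (`phiBar_mem_pow`).
-/

namespace SymGrothendieck

/-! ### Words and their contents -/

/-- The content of a word `f : α → ι`: the number of occurrences of each letter. -/
def content {α ι : Type} [Fintype α] [DecidableEq ι] (f : α → ι) (i : ι) : ℕ :=
  (Finset.univ.filter fun x => f x = i).card

/-- The number of words with letters in `ι` and content `c` that are fixed by the
permutation `g` of the positions. -/
def wordCount {α ι : Type} [Fintype α] [DecidableEq α] [Fintype ι] [DecidableEq ι]
    (c : ι → ℕ) (g : Equiv.Perm α) : ℕ :=
  (Finset.univ.filter fun f : α → ι => f ∘ g = f ∧ content f = c).card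

section Content

variable {α β ι κ : Type} [Fintype α] [Fintype β] [DecidableEq ι] [DecidableEq κ]

theorem content_comp_equiv (f : α → ι) (e : β ≃ α) : content (f ∘ e) = content f := by
  funext i
  refine Finset.card_bij' (fun x _ => e x) (fun x _ => e.symm x) ?_ ?_ ?_ ?_ <;> simp

theorem sum_content [Fintype ι] (f : α → ι) : ∑ i, content f i = Fintype.card α := by
  simp only [content]
  rw [← Finset.card_eq_sum_card_fiberwise (fun x _ => Finset.mem_coe.2 (Finset.mem_univ (f x)))]
  rfl

theorem exists_equiv_of_fibers {γ : Type} (f : α → γ) (g : β → γ) [DecidableEq γ]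
    (h : content f = content g) : ∃ e : α ≃ β, g ∘ e = f := by
  have h1 : ∀ c, Nonempty ({a // f a = c} ≃ {b // g b = c}) := fun c => by
    refine ⟨Fintype.equivOfCardEq ?_⟩
    rw [Fintype.card_subtype, Fintype.card_subtype]
    exact congrFun h c
  exact ⟨Equiv.ofFiberEquiv fun c => (h1 c).some,
    funext fun a => Equiv.ofFiberEquiv_map (fun c => (h1 c).some) a⟩

theorem content_eq_count {γ : Type} [DecidableEq γ] (f : α → γ) (c : γ) :
    content f c = ((Finset.univ : Finset α).val.map f).count c := by
  rw [Multiset.count_map, content, ← Finset.filter_val, Finset.card_val]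
  simp only [eq_comm]

/-- Marginals of the content of a two-row word. -/
theorem content_fst [Fintype ι] [Fintype κ] (f : α → ι × κ) (i : ι) :
    content (fun x => (f x).1) i = ∑ j, content f (i, j) := by
  simp only [content]
  rw [Finset.card_eq_sum_card_fiberwise (f := fun x => (f x).2) (t := Finset.univ)
    (fun x _ => Finset.mem_coe.2 (Finset.mem_univ _))]
  refine Finset.sum_congr rfl fun j _ => ?_
  rw [Finset.filter_filter]
  simp only [Prod.ext_iff]

theorem content_snd [Fintype ι] [Fintype κ] (f : α → ι × κ) (j : κ) :
    content (fun x => (f x).2) j = ∑ i, content f (i, j) := by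
  simp only [content]
  rw [Finset.card_eq_sum_card_fiberwise (f := fun x => (f x).1) (t := Finset.univ)
    (fun x _ => Finset.mem_coe.2 (Finset.mem_univ _))]
  refine Finset.sum_congr rfl fun i _ => ?_
  rw [Finset.filter_filter]
  simp only [Prod.ext_iff, and_comm]

end Content

/-! ### Counting fixed words -/

section WordCount

variable {α β ι κ : Type} [Fintype α] [DecidableEq α] [Fintype β] [DecidableEq β]
  [Fintype ι] [DecidableEq ι] [Fintype κ] [DecidableEq κ]

theorem wordCount_permCongr (c : ι → ℕ) (g : Equiv.Perm α) (e : α ≃ β) :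
    wordCount c (e.permCongr g) = wordCount c g := by
  refine Finset.card_bij' (fun f _ => f ∘ e) (fun f _ => f ∘ e.symm) ?_ ?_ ?_ ?_
  · intro f hf
    simp only [Finset.mem_filter, Finset.mem_univ, true_and] at hf ⊢
    refine ⟨funext fun x => ?_, by rw [content_comp_equiv, hf.2]⟩
    have := congrFun hf.1 (e x)
    simpa using this
  · intro f hf
    simp only [Finset.mem_filter, Finset.mem_univ, true_and] at hf ⊢
    refine ⟨funext fun x => ?_, by rw [content_comp_equiv, hf.2]⟩
    have := congrFun hf.1 (e.symm x)
    simpa using this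
  · intro f _; funext x; simp
  · intro f _; funext x; simp

/-- Letters may be renamed, and letters that do not occur may be added, without changing the
number of fixed words. -/
theorem wordCount_extend (c : κ → ℕ) (d : ι → ℕ) (e : κ → ι) (he : Function.Injective e)
    (hc : ∀ k, d (e k) = c k) (hd : ∀ i, i ∉ Set.range e → d i = 0) (g : Equiv.Perm α) :
    wordCount c g = wordCount d g := by
  have hcont : ∀ (f : α → κ) (k : κ), content (e ∘ f) (e k) = content f k := by
    intro f k
    simp only [content, Function.comp_apply, he.eq_iff]
  have hcont' : ∀ (f : α → κ) (i : ι), i ∉ Set.range e → content (e ∘ f) i = 0 := by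
    intro f i hi
    rw [content, Finset.card_eq_zero, Finset.filter_eq_empty_iff]
    intro x _ hx
    exact hi ⟨f x, hx⟩
  refine Finset.card_bij (fun f _ => e ∘ f) ?_ ?_ ?_
  · intro f hf
    simp only [Finset.mem_filter, Finset.mem_univ, true_and] at hf ⊢
    refine ⟨by rw [Function.comp_assoc, hf.1], funext fun i => ?_⟩
    by_cases hi : i ∈ Set.range e
    · obtain ⟨k, rfl⟩ := hi
      rw [hcont, hc, hf.2]
    · rw [hcont' _ _ hi, hd _ hi]
  · intro f _ f' _ h
    exact he.comp_left h
  · intro f hf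
    simp only [Finset.mem_filter, Finset.mem_univ, true_and] at hf
    have hr : ∀ x, f x ∈ Set.range e := by
      intro x
      by_contra hx
      have h0 := hd _ hx
      rw [← hf.2, content, Finset.card_eq_zero, Finset.filter_eq_empty_iff] at h0
      exact h0 (Finset.mem_univ x) rfl
    choose f' hf' using hr
    have hff : e ∘ f' = f := funext hf'
    refine ⟨f', ?_, hff⟩
    simp only [Finset.mem_filter, Finset.mem_univ, true_and]
    refine ⟨he.comp_left ?_, funext fun k => ?_⟩
    · change e ∘ (f' ∘ g) = e ∘ f'
      rw [← Function.comp_assoc, hff, hf.1]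
    · rw [← hcont, hff, hf.2, hc]

/-- The number of fixed words depends only on the multiset of nonzero multiplicities. -/
theorem wordCount_congr (c : ι → ℕ) (d : κ → ℕ)
    (h : ((Finset.univ : Finset ι).val.map c).filter (· ≠ 0) =
      ((Finset.univ : Finset κ).val.map d).filter (· ≠ 0)) (g : Equiv.Perm α) :
    wordCount c g = wordCount d g := by
  let c' : {i // c i ≠ 0} → ℕ := fun i => c i
  let d' : {i // d i ≠ 0} → ℕ := fun i => d i
  have hc : wordCount c' g = wordCount c g :=
    wordCount_extend c' c Subtype.val Subtype.val_injective (fun _ => rfl)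
      (fun i hi => by
        by_contra h0
        exact hi ⟨⟨i, h0⟩, rfl⟩) g
  have hd : wordCount d' g = wordCount d g :=
    wordCount_extend d' d Subtype.val Subtype.val_injective (fun _ => rfl)
      (fun i hi => by
        by_contra h0
        exact hi ⟨⟨i, h0⟩, rfl⟩) g
  have hcont : content c' = content d' := by
    funext v
    by_cases hv : v = 0
    · subst hv
      rw [content, content, Finset.filter_false_of_mem (fun i _ => i.2),
        Finset.filter_false_of_mem (fun i _ => i.2)]
      rfl
    · have key : ∀ {σ : Type} [Fintype σ] [DecidableEq σ] (s : σ → ℕ),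
          content (fun i : {i // s i ≠ 0} => s i) v =
            (((Finset.univ : Finset σ).val.map s).filter (· ≠ 0)).count v := by
        intro σ _ _ s
        rw [Multiset.count_filter_of_pos (by exact hv), ← content_eq_count]
        refine Finset.card_bij (fun i _ => i.1) ?_ ?_ ?_
        · intro i hi
          simpa using hi
        · intro i _ j _ hij
          exact Subtype.ext hij
        · intro i hi
          simp only [Finset.mem_filter, Finset.mem_univ, true_and] at hi
          exact ⟨⟨i, by rw [hi]; exact hv⟩, by simpa using hi, rfl⟩
      rw [key c, key d, h]
  obtain ⟨e, he⟩ := exists_equiv_of_fibers c' d' hcont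
  rw [← hc, ← hd]
  refine wordCount_extend c' d' e e.injective (fun k => congrFun he k) (fun i hi => ?_) g
  exact absurd (e.surjective i) (fun ⟨k, hk⟩ => hi ⟨k, hk⟩)

theorem wordCount_eq_zero_of_sum_ne (c : ι → ℕ) (h : ∑ i, c i ≠ Fintype.card α)
    (g : Equiv.Perm α) : wordCount c g = 0 := by
  rw [wordCount, Finset.card_eq_zero, Finset.filter_eq_empty_iff]
  rintro f - ⟨-, rfl⟩
  exact h (sum_content f)

/-- A word fixed by `g` with letters in `ι × κ` is a pair of words fixed by `g`; sorting the
pairs of words by their joint content gives a sum over matrices with prescribed marginals. -/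
theorem wordCount_mul (c : ι → ℕ) (d : κ → ℕ) (g : Equiv.Perm α) :
    wordCount c g * wordCount d g =
      ∑ M ∈ (Finset.piAntidiag (Finset.univ : Finset (ι × κ)) (Fintype.card α)).filter
        (fun M => (∀ i, ∑ j, M (i, j) = c i) ∧ ∀ j, ∑ i, M (i, j) = d j), wordCount M g := by
  rw [wordCount, wordCount, ← Finset.card_product]
  have hmap : ∀ q ∈ (Finset.univ.filter fun f : α → ι => f ∘ g = f ∧ content f = c) ×ˢ
      (Finset.univ.filter fun f : α → κ => f ∘ g = f ∧ content f = d),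
      content (fun x => (q.1 x, q.2 x)) ∈
        (Finset.piAntidiag (Finset.univ : Finset (ι × κ)) (Fintype.card α)).filter
        (fun M => (∀ i, ∑ j, M (i, j) = c i) ∧ ∀ j, ∑ i, M (i, j) = d j) := by
    rintro ⟨f, h⟩ hq
    simp only [Finset.mem_product, Finset.mem_filter, Finset.mem_univ, true_and] at hq
    simp only [Finset.mem_filter, Finset.mem_piAntidiag, Finset.mem_univ, implies_true,
      and_true]
    refine ⟨sum_content _, fun i => ?_, fun j => ?_⟩
    · rw [← content_fst, ← hq.1.2]
    · rw [← content_snd, ← hq.2.2]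
  rw [Finset.card_eq_sum_card_fiberwise hmap]
  refine Finset.sum_congr rfl fun M hM => ?_
  simp only [Finset.mem_filter] at hM
  refine Finset.card_bij' (fun q _ => fun x => (q.1 x, q.2 x))
    (fun f _ => (fun x => (f x).1, fun x => (f x).2)) ?_ ?_ ?_ ?_
  · rintro ⟨f, h⟩ hq
    simp only [Finset.mem_product, Finset.mem_filter, Finset.mem_univ, true_and] at hq ⊢
    exact ⟨funext fun x => Prod.ext (congrFun hq.1.1.1 x) (congrFun hq.1.2.1 x), hq.2⟩
  · intro f hf
    simp only [Finset.mem_product, Finset.mem_filter, Finset.mem_univ, true_and] at hf ⊢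
    refine ⟨⟨⟨?_, ?_⟩, ?_, ?_⟩, hf.2⟩
    · funext x; exact congrArg Prod.fst (congrFun hf.1 x)
    · funext i; rw [content_fst, hf.2, hM.2.1]
    · funext x; exact congrArg Prod.snd (congrFun hf.1 x)
    · funext i; rw [content_snd, hf.2, hM.2.2]
  · intro q _; rfl
  · intro f _; rfl

end WordCount

/-! ### Permutation characters on Young subgroups -/

section PermChar

open Classical in
/-- The permutation character on the cosets of the stabilizer of a word counts the fixed words
with the same content. -/
theorem permChar_eq_wordCount {α ι : Type} [Fintype α] [DecidableEq α] [Fintype ι]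
    [DecidableEq ι] (w : α → ι) (H : Subgroup (Equiv.Perm α))
    (hH : ∀ σ, σ ∈ H ↔ w ∘ σ = w) (g : Equiv.Perm α) :
    permChar H g = wordCount (content w) g := by
  rw [permChar, inducedFunction]
  have hne : (Nat.card H : ℂ) ≠ 0 := by exact_mod_cast Nat.card_pos.ne'
  rw [inv_mul_eq_iff_eq_mul₀ hne]
  have h1 : ∀ x : Equiv.Perm α, (x⁻¹ * g * x ∈ H) ↔ (w ∘ ⇑x⁻¹) ∘ g = w ∘ ⇑x⁻¹ := by
    intro x
    rw [hH]
    constructor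
    · intro h
      funext y
      have := congrFun h (x⁻¹ y)
      simpa using this
    · intro h
      funext y
      have := congrFun h (x y)
      simpa using this
  simp only [dite_eq_ite]
  rw [Finset.sum_boole]
  rw [Finset.card_eq_sum_card_fiberwise (f := fun x : Equiv.Perm α => w ∘ ⇑x⁻¹)
    (t := Finset.univ.filter fun f : α → ι => f ∘ g = f ∧ content f = content w)]
  · rw [Finset.sum_congr rfl (g := fun _ => Nat.card H), Finset.sum_const, smul_eq_mul, wordCount]
    · push_cast; ring
    intro f hf
    simp only [Finset.mem_filter, Finset.mem_univ, true_and] at hf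
    obtain ⟨e, he⟩ := exists_equiv_of_fibers f w hf.2
    rw [← Fintype.card_coe, ← Nat.card_eq_fintype_card]
    refine Nat.card_congr
      { toFun := fun x => ⟨e * x.1, ?_⟩
        invFun := fun h => ⟨e⁻¹ * h.1, ?_⟩
        left_inv := fun x => ?_
        right_inv := fun x => ?_ }
    · have hx := x.2
      rw [Finset.mem_filter] at hx
      rw [hH]
      funext y
      have h2 := congrFun hx.2 (x.1 y)
      have h3 := congrFun he (x.1 y)
      simp at h2 h3
      simp [h3, h2]
    · have hh := (hH _).1 h.2
      have hf2 : w ∘ ⇑(e⁻¹ * h.1)⁻¹ = f := by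
        funext y
        have h2 := congrFun hh ((h.1)⁻¹ (e y))
        simp at h2
        simp [← h2, ← he]
      simp only [Finset.mem_filter]
      refine ⟨⟨Finset.mem_univ _, ?_⟩, hf2⟩
      rw [h1, hf2, hf.1]
    · simp
    · simp
  · intro x hx
    simp only [Finset.coe_filter, Finset.mem_univ, true_and, Set.mem_ofPred_eq] at hx ⊢
    exact ⟨(h1 x).1 hx, content_comp_equiv w x⁻¹⟩

theorem content_index {n : ℕ} (c : Composition n) : content c.index = c.blocksFun := by
  funext i
  rw [content, ← Fintype.card_subtype]
  have e : {x // c.index x = i} ≃ {y : Σ i : Fin c.length, Fin (c.blocksFun i) // y.1 = i} :=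
    c.blocksFinEquiv.symm.subtypeEquiv fun x => Iff.rfl
  rw [Fintype.card_congr e, Fintype.card_congr (Equiv.sigmaSubtype i), Fintype.card_fin]

theorem map_blocksFun_toComposition {n : ℕ} (l : n.Partition) :
    (Finset.univ.val.map (toComposition l).blocksFun) = l.parts := by
  have : (Finset.univ.val.map (toComposition l).blocksFun) =
      (((toComposition l).blocks : List ℕ) : Multiset ℕ) := by
    rw [← Composition.ofFn_blocksFun, Fin.univ_val_map]
  rw [this]
  exact Multiset.sort_eq _ _

theorem phi_apply {n : ℕ} (l : n.Partition) {ι : Type} [Fintype ι] [DecidableEq ι] (c : ι → ℕ)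
    (hc : (Finset.univ.val.map c).filter (· ≠ 0) = l.parts) (g : Equiv.Perm (Fin n)) :
    (phi l).1 g = wordCount c g := by
  change permChar (youngSubgroup (toComposition l)) g = _
  rw [permChar_eq_wordCount (toComposition l).index _ (fun σ => ?_), content_index]
  · congr 1
    apply wordCount_congr
    rw [map_blocksFun_toComposition, hc, Multiset.filter_eq_self]
    intro a ha
    exact (l.parts_pos ha).ne'
  · exact ⟨fun h => funext h, fun h x => congrFun h x⟩

end PermChar

/-! ### Permutations with prescribed cycle lengths -/

section Cycles

theorem apply_eq_of_comp_finRotate {ι : Type} {m : ℕ} (h : Fin m → ι) (hh : h ∘ finRotate m = h)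
    (i j : Fin m) : h i = h j := by
  cases m with
  | zero => exact i.elim0
  | succ m =>
    have key : ∀ i, h i = h 0 := by
      intro i
      induction i using Fin.induction with
      | zero => rfl
      | succ i ih =>
        rw [← ih, ← congrFun hh i.castSucc]
        simp
    rw [key i, key j]

/-- For every family `s` of positive cycle lengths with sum `n` there is a permutation whose
fixed words are the colourings of the cycles. -/
theorem exists_perm_wordCount {n : ℕ} {κ : Type} [Fintype κ] [DecidableEq κ] (s : κ → ℕ)
    (hs : ∀ k, 0 < s k) (hn : ∑ k, s k = n) :
    ∃ g : Equiv.Perm (Fin n), ∀ (ι : Type) [Fintype ι] [DecidableEq ι] (c : ι → ℕ),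
      wordCount c g = (Finset.univ.filter fun F : κ → ι =>
        ∀ i, ∑ q ∈ Finset.univ.filter (fun q => F q = i), s q = c i).card := by
  have e : (Σ k, Fin (s k)) ≃ Fin n := Fintype.equivFinOfCardEq (by simp [hn])
  let g : Equiv.Perm (Σ k, Fin (s k)) := Equiv.sigmaCongrRight fun k => finRotate (s k)
  refine ⟨e.permCongr g, fun ι _ _ c => ?_⟩
  rw [wordCount_permCongr]
  have hcont : ∀ F : κ → ι, content (fun x : Σ k, Fin (s k) => F x.1) =
      fun i => ∑ q ∈ Finset.univ.filter (fun q => F q = i), s q := by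
    intro F
    funext i
    have : (Finset.univ.filter fun x : Σ k, Fin (s k) => F x.1 = i) =
        (Finset.univ.filter (fun q => F q = i)).sigma fun q => Finset.univ := by
      ext x; simp
    rw [content, this, Finset.card_sigma]
    simp
  refine Finset.card_bij' (fun f _ => fun k => f ⟨k, ⟨0, hs k⟩⟩)
    (fun F _ => fun x => F x.1) ?_ ?_ ?_ ?_
  · intro f hf
    simp only [Finset.mem_filter, Finset.mem_univ, true_and] at hf ⊢
    have hf' : (fun x : Σ k, Fin (s k) => f ⟨x.1, ⟨0, hs x.1⟩⟩) = f := by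
      funext ⟨k, j⟩
      refine apply_eq_of_comp_finRotate (fun j => f ⟨k, j⟩) ?_ _ _
      funext j
      exact congrFun hf.1 ⟨k, j⟩
    have h2 := hcont fun k => f ⟨k, ⟨0, hs k⟩⟩
    rw [hf', hf.2] at h2
    exact fun i => (congrFun h2 i).symm
  · intro F hF
    simp only [Finset.mem_filter, Finset.mem_univ, true_and] at hF ⊢
    exact ⟨rfl, by rw [hcont]; exact funext hF⟩
  · intro f hf
    simp only [Finset.mem_filter, Finset.mem_univ, true_and] at hf
    funext ⟨k, j⟩
    refine apply_eq_of_comp_finRotate (fun j => f ⟨k, j⟩) ?_ _ _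
    funext j
    exact congrFun hf.1 ⟨k, j⟩
  · intro F _
    rfl

end Cycles

/-! ### Triangularity of the values -/

section Triangular

/-- The parts of a partition as a family indexed by a finite type. -/
abbrev partFun {n : ℕ} (l : n.Partition) : Fin (toComposition l).length → ℕ :=
  (toComposition l).blocksFun

theorem partFun_pos {n : ℕ} (l : n.Partition) (i) : 0 < partFun l i :=
  (toComposition l).blocks_pos ((toComposition l).blocksFun_mem_blocks i)

theorem sum_partFun {n : ℕ} (l : n.Partition) : ∑ i, partFun l i = n :=
  (toComposition l).sum_blocksFun

theorem phi_apply_partFun {n : ℕ} (l : n.Partition) (g : Equiv.Perm (Fin n)) :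
    (phi l).1 g = wordCount (partFun l) g := by
  refine phi_apply l _ ?_ g
  rw [map_blocksFun_toComposition, Multiset.filter_eq_self]
  exact fun a ha => (l.parts_pos ha).ne'

theorem card_partFun {n : ℕ} (l : n.Partition) :
    Fintype.card (Fin (toComposition l).length) = l.parts.card := by
  conv_rhs => rw [← map_blocksFun_toComposition l]
  simp

/-- A permutation whose cycle lengths, fixed points included, are the parts of the partition. -/
noncomputable def permOfPartition {n : ℕ} (l : n.Partition) : Equiv.Perm (Fin n) :=
  (exists_perm_wordCount (partFun l) (partFun_pos l) (sum_partFun l)).choose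

theorem wordCount_permOfPartition {n : ℕ} (l : n.Partition) {ι : Type} [Fintype ι]
    [DecidableEq ι] (c : ι → ℕ) :
    wordCount c (permOfPartition l) =
      (Finset.univ.filter fun F : Fin (toComposition l).length → ι =>
        ∀ i, ∑ q ∈ Finset.univ.filter (fun q => F q = i), partFun l q = c i).card :=
  (exists_perm_wordCount (partFun l) (partFun_pos l) (sum_partFun l)).choose_spec ι c

theorem surjective_of_sum_fiber {κ ι : Type} [Fintype κ] [DecidableEq ι] (s : κ → ℕ) (c : ι → ℕ)
    (hc : ∀ i, 0 < c i) (F : κ → ι)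
    (hF : ∀ i, ∑ q ∈ Finset.univ.filter (fun q => F q = i), s q = c i) :
    Function.Surjective F := by
  intro i
  by_contra h
  have h0 := hF i
  rw [Finset.filter_false_of_mem (fun q _ hq => h ⟨q, hq⟩), Finset.sum_empty] at h0
  exact (hc i).ne h0

theorem comp_eq_of_sum_fiber {κ ι : Type} [Fintype κ] [DecidableEq ι] (s : κ → ℕ) (c : ι → ℕ)
    (F : κ → ι) (hF : ∀ i, ∑ q ∈ Finset.univ.filter (fun q => F q = i), s q = c i)
    (hinj : Function.Injective F) : c ∘ F = s := by
  funext q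
  classical
  have : (Finset.univ.filter fun q' => F q' = F q) = {q} := by
    ext q'; simp [hinj.eq_iff]
  rw [Function.comp_apply, ← hF, this, Finset.sum_singleton]

/-- If `φ_l` does not vanish at a permutation of cycle type `m`, then `m` refines `l`; so the two
coincide if `l` has at least as many parts as `m`. -/
theorem eq_of_wordCount_ne_zero {n : ℕ} (l m : n.Partition)
    (h : wordCount (partFun l) (permOfPartition m) ≠ 0)
    (hc : m.parts.card ≤ l.parts.card) : l = m := by
  rw [wordCount_permOfPartition, Finset.card_ne_zero] at h
  obtain ⟨F, hF⟩ := h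
  simp only [Finset.mem_filter, Finset.mem_univ, true_and] at hF
  have hs := surjective_of_sum_fiber _ _ (partFun_pos l) F hF
  rw [← card_partFun, ← card_partFun] at hc
  have hb : Function.Bijective F :=
    (Fintype.bijective_iff_surjective_and_card F).2
      ⟨hs, le_antisymm hc (Fintype.card_le_of_surjective F hs)⟩
  have h1 := comp_eq_of_sum_fiber _ _ F hF hb.1
  apply Nat.Partition.ext
  rw [← map_blocksFun_toComposition l, ← map_blocksFun_toComposition m]
  change _ = Finset.univ.val.map (partFun m)
  rw [← h1]
  rw [← Multiset.map_map]
  congr 1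
  have := Finset.map_univ_equiv (Equiv.ofBijective F hb)
  rw [← this]
  rfl

/-- The value of `φ_l` at a permutation of cycle type `l` is `∏ k, r_k(l)!`. -/
theorem wordCount_permOfPartition_self {n : ℕ} (l : n.Partition) :
    wordCount (partFun l) (permOfPartition l) =
      ∏ k ∈ l.parts.toFinset, (l.parts.count k).factorial := by
  have h1 : ∏ k ∈ l.parts.toFinset, (l.parts.count k).factorial =
      Fintype.card {g : Equiv.Perm (Fin (toComposition l).length) //
        partFun l ∘ g = partFun l} := by
    rw [DomMulAct.stabilizer_card']
    have hi : l.parts.toFinset = Finset.univ.image (partFun l) := by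
      conv_lhs => rw [← map_blocksFun_toComposition l]
      ext k
      rw [Multiset.mem_toFinset, Multiset.mem_map, Finset.mem_image]
      rfl
    rw [hi]
    refine Finset.prod_congr rfl fun k _ => ?_
    rw [Fintype.card_subtype]
    congr 1
    conv_lhs => rw [← map_blocksFun_toComposition l, ← content_eq_count]
    rfl
  rw [h1, wordCount_permOfPartition, Fintype.card_subtype]
  symm
  refine Finset.card_bij (fun g _ => ⇑g) ?_ ?_ ?_
  · intro g hg
    simp only [Finset.mem_filter, Finset.mem_univ, true_and] at hg ⊢
    intro i
    have : (Finset.univ.filter fun q => g q = i) = {g⁻¹ i} := by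
      ext q
      rw [Finset.mem_filter, Finset.mem_singleton, Equiv.Perm.eq_inv_iff_eq]
      simp
    rw [this, Finset.sum_singleton, ← congrFun hg]
    simp
  · intro g _ g' _ h
    exact DFunLike.coe_injective h
  · intro F hF
    simp only [Finset.mem_filter, Finset.mem_univ, true_and] at hF
    have hs := surjective_of_sum_fiber _ _ (partFun_pos l) F hF
    have hb : Function.Bijective F := Finite.surjective_iff_bijective.1 hs
    refine ⟨Equiv.ofBijective F hb, ?_, rfl⟩
    simp only [Finset.mem_filter, Finset.mem_univ, true_and]
    exact comp_eq_of_sum_fiber _ _ F hF hb.1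

/-- Triangularity of the values of the `φ_m`, over any field: a combination that vanishes at the
permutations whose type is in its support is zero, provided that the diagonal values involved are
nonzero in the field. -/
theorem coeff_eq_zero_of_sum_wordCount {n : ℕ} {K : Type} [Field K]
    (a : n.Partition → K)
    (hdiag : ∀ l, a l ≠ 0 → ((∏ k ∈ l.parts.toFinset, (l.parts.count k).factorial : ℕ) : K) ≠ 0)
    (h : ∀ l, a l ≠ 0 → ∑ m, a m * (wordCount (partFun m) (permOfPartition l) : K) = 0) :
    a = 0 := by
  classical
  by_contra hne
  -- the coarsest partition in the support sees no other member of the support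
  obtain ⟨l0, hl0⟩ := Function.ne_iff.1 hne
  obtain ⟨l, hl, hmin⟩ := Finset.exists_min_image (Finset.univ.filter fun l => a l ≠ 0)
    (fun l => l.parts.card) ⟨l0, by simpa using hl0⟩
  simp only [Finset.mem_filter, Finset.mem_univ, true_and] at hl hmin
  have h1 := h l hl
  rw [Finset.sum_eq_single l] at h1
  · rw [wordCount_permOfPartition_self] at h1
    exact (mul_ne_zero hl (hdiag l hl)) h1
  · intro m _ hm
    by_cases ham : a m = 0
    · rw [ham, zero_mul]
    · by_cases hw : wordCount (partFun m) (permOfPartition l) = 0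
      · rw [hw]; simp
      · exact absurd (eq_of_wordCount_ne_zero m l hw (hmin m ham)) hm
  · simp

end Triangular

/-! ### Class functions -/

section Class

theorem linearIndependent_phi (n : ℕ) :
    LinearIndependent ℂ (fun l : n.Partition => ((phi l).1 : Equiv.Perm (Fin n) → ℂ)) := by
  rw [Fintype.linearIndependent_iff]
  intro a ha
  refine congrFun (coeff_eq_zero_of_sum_wordCount a (fun l _ => ?_) fun l _ => ?_)
  · rw [Nat.cast_ne_zero, Finset.prod_ne_zero_iff]
    exact fun k _ => Nat.factorial_ne_zero _
  · have := congrFun ha (permOfPartition l)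
    simpa [Finset.sum_apply, phi_apply_partFun] using this

/-- The complex class functions on a finite group. -/
def classFunctions (G : Type) [Group G] : Submodule ℂ (G → ℂ) where
  carrier := {χ | ∀ g h, χ (h * g * h⁻¹) = χ g}
  add_mem' ha hb g h := by rw [Pi.add_apply, Pi.add_apply, ha, hb]
  zero_mem' _ _ := rfl
  smul_mem' c χ hχ g h := by rw [Pi.smul_apply, Pi.smul_apply, hχ]

theorem virtualCharacter_mem_classFunctions {G : Type} [Group G] {χ : G → ℂ}
    (hχ : χ ∈ virtualCharacterRing G) : χ ∈ classFunctions G := by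
  change χ ∈ AddSubgroup.closure {χ : G → ℂ | IsOrdinaryCharacter χ} at hχ
  have : AddSubgroup.closure {χ : G → ℂ | IsOrdinaryCharacter χ} ≤
      (classFunctions G).toAddSubgroup := by
    rw [AddSubgroup.closure_le]
    rintro _ ⟨V, _, _, _, ρ, rfl⟩ g h
    exact ρ.char_conj g h
  exact this hχ

theorem finrank_classFunctions_le (n : ℕ) :
    Module.finrank ℂ (classFunctions (Equiv.Perm (Fin n))) ≤ Fintype.card n.Partition := by
  classical
  let f : ((Fintype.card (Fin n)).Partition → ℂ) →ₗ[ℂ] (Equiv.Perm (Fin n) → ℂ) :=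
    LinearMap.funLeft ℂ ℂ Equiv.Perm.partition
  have hle : classFunctions (Equiv.Perm (Fin n)) ≤ LinearMap.range f := by
    intro χ hχ
    refine ⟨fun l => if h : ∃ g : Equiv.Perm (Fin n), g.partition = l then χ h.choose else 0, ?_⟩
    funext g
    change (if h : ∃ g' : Equiv.Perm (Fin n), g'.partition = g.partition then χ h.choose else 0)
      = χ g
    have hex : ∃ g' : Equiv.Perm (Fin n), g'.partition = g.partition := ⟨g, rfl⟩
    rw [dif_pos hex]
    have := Equiv.Perm.partition_eq_of_isConj.2 hex.choose_spec
    obtain ⟨c, hc⟩ := isConj_iff.1 this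
    rw [← hχ _ c, hc]
  calc _ ≤ Module.finrank ℂ (LinearMap.range f) := Submodule.finrank_mono hle
    _ ≤ Module.finrank ℂ ((Fintype.card (Fin n)).Partition → ℂ) := LinearMap.finrank_range_le f
    _ = Fintype.card n.Partition := by
      rw [Module.finrank_fintype_fun_eq_card, Fintype.card_fin]

theorem span_phi_eq_classFunctions (n : ℕ) :
    Submodule.span ℂ (Set.range fun l : n.Partition => ((phi l).1 : Equiv.Perm (Fin n) → ℂ)) =
      classFunctions (Equiv.Perm (Fin n)) := by
  apply Submodule.eq_of_le_of_finrank_le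
  · rw [Submodule.span_le]
    rintro _ ⟨l, rfl⟩
    exact virtualCharacter_mem_classFunctions (phi l).2
  · rw [finrank_span_eq_card (linearIndependent_phi n)]
    exact finrank_classFunctions_le n

end Class

/-! ### Integral combinations of elementary symmetric polynomials -/

section Elementary

open MvPolynomial

theorem esymm_isHomogeneous (σ K : Type) [Fintype σ] [CommRing K] (k : ℕ) :
    (esymm σ K k).IsHomogeneous k := by
  refine IsHomogeneous.sum _ _ _ fun t ht => ?_
  have h := IsHomogeneous.prod t (fun i => (X i : MvPolynomial σ K)) (fun _ => 1)
    (fun i _ => isHomogeneous_X K i)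
  rw [Finset.sum_const, smul_eq_mul, mul_one, (Finset.mem_powersetCard.1 ht).2] at h
  exact h

/-- A homogeneous symmetric polynomial with integer coefficients is an integral combination of
the products `e_λ` of elementary symmetric polynomials. -/
theorem mem_span_esymmPart {n : ℕ} (P : MvPolynomial (Fin n) ℂ) (hsymm : P.IsSymmetric)
    (hhom : P.IsHomogeneous n) (hint : ∀ m, ∃ a : ℤ, coeff m P = a) :
    P ∈ Submodule.span ℤ (Set.range fun l : n.Partition => esymmPart (Fin n) ℂ l) := by
  obtain ⟨Q, hQ⟩ : P ∈ Set.range (MvPolynomial.map (σ := Fin n) (Int.castRingHom ℂ)) := by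
    rw [mem_range_map_iff_coeffs_subset]
    intro c hc
    obtain ⟨m, -, rfl⟩ := mem_coeffs_iff.1 hc
    obtain ⟨a, ha⟩ := hint m
    exact ⟨a, ha.symm⟩
  have hinj : Function.Injective (MvPolynomial.map (σ := Fin n) (Int.castRingHom ℂ)) :=
    map_injective _ Int.cast_injective
  have hQs : Q.IsSymmetric := by
    intro e
    apply hinj
    rw [map_rename, hQ, hsymm]
  obtain ⟨q, hq⟩ := (esymmAlgHom_fin_bijective ℤ n).2 ⟨Q, hQs⟩
  have hq' : aeval (fun i : Fin n => esymm (Fin n) ℂ (i + 1)) q = P := by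
    rw [← hQ, ← show (esymmAlgHom (Fin n) ℤ n q).val = Q from congrArg Subtype.val hq,
      esymmAlgHom_apply]
    clear hq
    induction q using MvPolynomial.induction_on with
    | C a => simp
    | add p q hp hq => rw [_root_.map_add, hp, hq, _root_.map_add, _root_.map_add]
    | mul_X p i hp => rw [_root_.map_mul, hp, _root_.map_mul, _root_.map_mul]; simp [map_esymm]
  have hcomp : homogeneousComponent n P = P := homogeneousComponent_eq_self hhom
  rw [← hcomp, ← hq', q.as_sum, _root_.map_sum, _root_.map_sum]
  refine Submodule.sum_mem _ fun t _ => ?_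
  have hmono : aeval (fun i : Fin n => esymm (Fin n) ℂ (i + 1)) (monomial t (coeff t q)) =
      coeff t q • ∏ i : Fin n, esymm (Fin n) ℂ (i + 1) ^ t i := by
    rw [aeval_monomial, Finsupp.prod_fintype _ _ (fun i => pow_zero _), Algebra.smul_def]
  rw [hmono, _root_.map_zsmul]
  refine Submodule.smul_mem _ _ ?_
  have hh : (∏ i : Fin n, esymm (Fin n) ℂ (i + 1) ^ t i).IsHomogeneous
      (∑ i : Fin n, ((i : ℕ) + 1) * t i) :=
    IsHomogeneous.prod _ _ _ fun i _ => (esymm_isHomogeneous _ _ _).pow _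
  rw [homogeneousComponent_of_mem hh]
  split_ifs with hdeg
  · apply Submodule.subset_span
    refine ⟨⟨∑ i : Fin n, Multiset.replicate (t i) (i + 1), ?_, ?_⟩, ?_⟩
    · intro k hk
      rw [Multiset.mem_sum] at hk
      obtain ⟨i, -, hi⟩ := hk
      rw [Multiset.eq_of_mem_replicate hi]
      exact Nat.succ_pos _
    · refine Eq.trans ?_ hdeg.symm
      rw [Multiset.sum_sum]
      refine Finset.sum_congr rfl fun i _ => ?_
      rw [Multiset.sum_replicate, smul_eq_mul, mul_comm]
    · change (Multiset.map _ (∑ i : Fin n, Multiset.replicate (t i) ((i : ℕ) + 1))).prod = _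
      have : ∀ s : Finset (Fin n), (Multiset.map (esymm (Fin n) ℂ)
          (∑ i ∈ s, Multiset.replicate (t i) ((i : ℕ) + 1))).prod =
          ∏ i ∈ s, esymm (Fin n) ℂ (i + 1) ^ t i := by
        intro s
        induction s using Finset.induction_on with
        | empty => simp
        | insert a s ha ih =>
          rw [Finset.sum_insert ha, Finset.prod_insert ha, Multiset.map_add, Multiset.prod_add, ih]
          simp
      exact this _
  · exact Submodule.zero_mem _

/-- Each squarefree monomial of degree `#T` arises from `#T!` injective words. -/
theorem sum_injective_prod_X {σ T : Type} [Fintype σ] [DecidableEq σ] [Fintype T]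
    [DecidableEq T] :
    ∑ h ∈ Finset.univ.filter (fun h : T → σ => Function.Injective h),
      ∏ x, (X (h x) : MvPolynomial σ ℂ) =
      ((Fintype.card T).factorial : MvPolynomial σ ℂ) * esymm σ ℂ (Fintype.card T) := by
  rw [esymm, Finset.mul_sum]
  rw [← Finset.sum_fiberwise_of_maps_to (g := fun h : T → σ => Finset.univ.image h)
    (t := Finset.powersetCard (Fintype.card T) Finset.univ)]
  · refine Finset.sum_congr rfl fun t ht => ?_
    rw [Finset.mem_powersetCard] at ht
    rw [Finset.sum_congr rfl (g := fun _ => ∏ i ∈ t, (X i : MvPolynomial σ ℂ)),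
      Finset.sum_const, nsmul_eq_mul]
    · congr 2
      have e0 : Nonempty (T ≃ t) := ⟨Fintype.equivOfCardEq (by rw [Fintype.card_coe, ht.2])⟩
      obtain ⟨e0⟩ := e0
      rw [← Fintype.card_equiv e0, ← Finset.card_univ]
      symm
      refine Finset.card_bij (fun e _ => fun x => (e x : σ)) ?_ ?_ ?_
      · intro e _
        rw [Finset.mem_filter, Finset.mem_filter]
        refine ⟨⟨Finset.mem_univ _, fun x y hxy => e.injective (Subtype.ext hxy)⟩, ?_⟩
        ext i
        rw [Finset.mem_image]
        constructor
        · rintro ⟨x, -, rfl⟩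
          exact (e x).2
        · intro hi
          exact ⟨e.symm ⟨i, hi⟩, Finset.mem_univ _, by simp⟩
      · intro e _ e' _ h
        ext x
        exact congrFun h x
      · intro h hh
        rw [Finset.mem_filter, Finset.mem_filter] at hh
        have hmem : ∀ x, h x ∈ t := fun x => by
          rw [← hh.2]; exact Finset.mem_image_of_mem _ (Finset.mem_univ x)
        refine ⟨Equiv.ofBijective (fun x => (⟨h x, hmem x⟩ : t)) ?_, Finset.mem_univ _, rfl⟩
        rw [Fintype.bijective_iff_injective_and_card]
        refine ⟨fun x y hxy => hh.1.2 (congrArg Subtype.val hxy), ?_⟩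
        rw [Fintype.card_coe, ht.2]
    · intro h hh
      rw [Finset.mem_filter, Finset.mem_filter] at hh
      rw [← hh.2, Finset.prod_image (fun x _ y _ hxy => hh.1.2 hxy)]
  · intro h hh
    rw [Finset.mem_filter] at hh
    rw [Finset.mem_powersetCard]
    exact ⟨Finset.subset_univ _, by rw [Finset.card_image_of_injective _ hh.2, Finset.card_univ]⟩

end Elementary

/-! ### The twisted Frobenius characteristic and the integral basis -/

section Frobenius

open MvPolynomial

/-- The generating function, by content, of the words in `n` letters of length `n` that are
fixed by `g`. -/
noncomputable def wordPoly {n : ℕ} (g : Equiv.Perm (Fin n)) : MvPolynomial (Fin n) ℂ :=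
  ∑ f ∈ Finset.univ.filter (fun f : Fin n → Fin n => f ∘ g = f), ∏ x, X (f x)

theorem prod_X_eq_monomial {n : ℕ} (f : Fin n → Fin n) :
    ∏ x, (X (f x) : MvPolynomial (Fin n) ℂ) =
      monomial (Finsupp.equivFunOnFinite.symm (content f)) 1 := by
  have : Finsupp.equivFunOnFinite.symm (content f) = ∑ x, Finsupp.single (f x) 1 := by
    ext i
    rw [Finsupp.finsetSum_apply]
    simp [content, Finsupp.single_apply, Finset.sum_boole]
  rw [this, monomial_sum_one]
  rfl

theorem coeff_wordPoly {n : ℕ} (g : Equiv.Perm (Fin n)) (m : Fin n →₀ ℕ) :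
    coeff m (wordPoly g) = wordCount m g := by
  rw [wordPoly, coeff_sum, wordCount, ← Finset.filter_filter, Finset.card_filter]
  push_cast
  refine Finset.sum_congr rfl fun f _ => ?_
  rw [prod_X_eq_monomial, coeff_monomial]
  congr 1
  rw [eq_iff_iff, Equiv.symm_apply_eq]
  rfl

theorem wordPoly_isSymmetric {n : ℕ} (g : Equiv.Perm (Fin n)) : (wordPoly g).IsSymmetric := by
  intro e
  rw [wordPoly, map_sum]
  refine Finset.sum_bij' (fun f _ => e ∘ f) (fun f _ => e.symm ∘ f) ?_ ?_ ?_ ?_ ?_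
  · intro f hf
    simp only [Finset.mem_filter, Finset.mem_univ, true_and] at hf ⊢
    rw [Function.comp_assoc, hf]
  · intro f hf
    simp only [Finset.mem_filter, Finset.mem_univ, true_and] at hf ⊢
    rw [Function.comp_assoc, hf]
  · intro f _; funext x; simp
  · intro f _; funext x; simp
  · intro f _; simp [map_prod]

theorem wordPoly_isHomogeneous {n : ℕ} (g : Equiv.Perm (Fin n)) :
    (wordPoly g).IsHomogeneous n := by
  refine IsHomogeneous.sum _ _ _ fun f _ => ?_
  have h := IsHomogeneous.prod Finset.univ (fun x => (X (f x) : MvPolynomial (Fin n) ℂ))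
    (fun _ => 1) (fun x _ => isHomogeneous_X ℂ (f x))
  rw [Finset.sum_const, smul_eq_mul, mul_one, Finset.card_univ, Fintype.card_fin] at h
  exact h

/-- The sign of a permutation as a complex number. -/
def signC {n : ℕ} (g : Equiv.Perm (Fin n)) : ℂ := ((Equiv.Perm.sign g : ℤ) : ℂ)

/-- The Frobenius characteristic in `n` variables of the product of `χ` with the sign
character: `(1 / n!) ∑ g, sgn(g) χ(g) ∏ p_{|c|}`, with the product of
the power sums `p_{|c|}` over the cycles `c` of `g`, which is expanded as a sum over words. -/
noncomputable def twistedFrobenius (n : ℕ) :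
    (Equiv.Perm (Fin n) → ℂ) →ₗ[ℂ] MvPolynomial (Fin n) ℂ where
  toFun χ := (n.factorial : ℂ)⁻¹ • ∑ g, (signC g * χ g) • wordPoly g
  map_add' χ ψ := by
    rw [← smul_add, ← Finset.sum_add_distrib]
    refine congrArg ((n.factorial : ℂ)⁻¹ • ·) (Finset.sum_congr rfl fun g _ => ?_)
    rw [Pi.add_apply, mul_add, add_smul]
  map_smul' a χ := by
    rw [RingHom.id_apply, smul_comm a]
    congr 1
    rw [Finset.smul_sum]
    refine Finset.sum_congr rfl fun g _ => ?_
    rw [Pi.smul_apply, smul_smul, smul_eq_mul]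
    congr 1
    ring

theorem twistedFrobenius_apply {n : ℕ} (χ : Equiv.Perm (Fin n) → ℂ) :
    twistedFrobenius n χ = (n.factorial : ℂ)⁻¹ • ∑ g, (signC g * χ g) • wordPoly g := rfl

theorem coeff_twistedFrobenius {n : ℕ} (χ : Equiv.Perm (Fin n) → ℂ) (m : Fin n →₀ ℕ) :
    coeff m (twistedFrobenius n χ) =
      (n.factorial : ℂ)⁻¹ * ∑ g, signC g * χ g * wordCount m g := by
  rw [twistedFrobenius_apply, coeff_smul, coeff_sum, smul_eq_mul]
  congr 1
  refine Finset.sum_congr rfl fun g _ => ?_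
  rw [coeff_smul, coeff_wordPoly, smul_eq_mul]

theorem twistedFrobenius_isSymmetric {n : ℕ} (χ : Equiv.Perm (Fin n) → ℂ) :
    (twistedFrobenius n χ).IsSymmetric := by
  intro e
  rw [twistedFrobenius_apply, map_smul, map_sum]
  refine congrArg ((n.factorial : ℂ)⁻¹ • ·) (Finset.sum_congr rfl fun g _ => ?_)
  rw [map_smul, wordPoly_isSymmetric]

theorem twistedFrobenius_isHomogeneous {n : ℕ} (χ : Equiv.Perm (Fin n) → ℂ) :
    (twistedFrobenius n χ).IsHomogeneous n := by
  refine (homogeneousSubmodule (Fin n) ℂ n).smul_mem _ (Submodule.sum_mem _ fun g _ => ?_)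
  exact (homogeneousSubmodule (Fin n) ℂ n).smul_mem _ (wordPoly_isHomogeneous g)

/-- The mean value of a virtual character is an integer. -/
theorem exists_int_average {G : Type} [Group G] [Fintype G] {χ : G → ℂ}
    (hχ : χ ∈ virtualCharacterRing G) : ∃ a : ℤ, (Nat.card G : ℂ)⁻¹ * ∑ g, χ g = a := by
  change χ ∈ AddSubgroup.closure {χ : G → ℂ | IsOrdinaryCharacter χ} at hχ
  induction hχ using AddSubgroup.closure_induction with
  | mem χ h =>
    obtain ⟨V, _, _, _, ρ, rfl⟩ := h
    have : Invertible (Nat.card G : ℂ) :=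
      invertibleOfNonzero (by exact_mod_cast Nat.card_pos.ne')
    exact ⟨_, by rw [ρ.card_inv_mul_sum_char_eq_finrank, ← Int.cast_natCast]⟩
  | zero => exact ⟨0, by simp⟩
  | add a b _ _ ha hb =>
    obtain ⟨i, hi⟩ := ha
    obtain ⟨j, hj⟩ := hb
    exact ⟨i + j, by simp only [Pi.add_apply]; rw [Finset.sum_add_distrib, mul_add, hi, hj, Int.cast_add]⟩
  | neg a _ ha =>
    obtain ⟨i, hi⟩ := ha
    exact ⟨-i, by simp only [Pi.neg_apply]; rw [Finset.sum_neg_distrib, mul_neg, hi, Int.cast_neg]⟩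

theorem signC_mem (n : ℕ) :
    (signC : Equiv.Perm (Fin n) → ℂ) ∈ virtualCharacterRing (Equiv.Perm (Fin n)) := by
  apply mem_virtualCharacterRing_of_isOrdinaryCharacter
  let s : Equiv.Perm (Fin n) →* ℂ :=
    ((Int.castRingHom ℂ : ℤ →* ℂ).comp (Units.coeHom ℤ)).comp Equiv.Perm.sign
  refine ⟨ℂ, inferInstance, inferInstance, inferInstance,
    (algebraMap ℂ (Module.End ℂ ℂ) : ℂ →* Module.End ℂ ℂ).comp s, ?_⟩
  funext g
  change LinearMap.trace ℂ ℂ (algebraMap ℂ (Module.End ℂ ℂ) (s g)) = _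
  rw [Algebra.algebraMap_eq_smul_one, map_smul, LinearMap.trace_one]
  simp [s, signC]

/-- The class function counting fixed words of content `c`, as a virtual character. It vanishes
when the sum of `c` is not `n`. -/
noncomputable def wordChar (n : ℕ) {ι : Type} [Fintype ι] [DecidableEq ι] (c : ι → ℕ) : R n :=
  ⟨fun g => (wordCount c g : ℂ), by
    by_cases h : (Finset.univ.val.map c).sum = n
    · have h2 : (fun g => (wordCount c g : ℂ)) = (phi (Nat.Partition.ofSums n _ h)).1 := by
        funext g
        rw [phi_apply _ c]
        simp [Nat.Partition.ofSums]
      rw [h2]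
      exact (phi _).2
    · have h2 : (fun g : Equiv.Perm (Fin n) => (wordCount c g : ℂ)) = 0 := by
        funext g
        rw [wordCount_eq_zero_of_sum_ne]
        · simp
        · rw [Fintype.card_fin]; exact h
      rw [h2]
      exact zero_mem _⟩

theorem wordChar_apply {n : ℕ} {ι : Type} [Fintype ι] [DecidableEq ι] (c : ι → ℕ)
    (g : Equiv.Perm (Fin n)) : (wordChar n c).1 g = wordCount c g := rfl

theorem wordChar_eq_phi {n : ℕ} {ι : Type} [Fintype ι] [DecidableEq ι] (c : ι → ℕ)
    (l : n.Partition) (h : (Finset.univ.val.map c).filter (· ≠ 0) = l.parts) :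
    wordChar n c = phi l := by
  apply Subtype.ext
  funext g
  rw [wordChar_apply, phi_apply l c h]

/-- The coefficients of the twisted Frobenius characteristic are mean values of the virtual
characters `sgn · χ · φ`, where `φ` counts fixed words. -/
theorem exists_int_coeff_twistedFrobenius {n : ℕ} {χ : Equiv.Perm (Fin n) → ℂ}
    (hχ : χ ∈ virtualCharacterRing (Equiv.Perm (Fin n))) (m : Fin n →₀ ℕ) :
    ∃ a : ℤ, coeff m (twistedFrobenius n χ) = a := by
  have := exists_int_average (mul_mem (mul_mem (signC_mem n) hχ) (wordChar n m).2)
  rw [coeff_twistedFrobenius]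
  rwa [Nat.card_perm, Nat.card_eq_fintype_card, Fintype.card_fin] at this

/-- A repeated letter gives a transposition in the stabilizer of the word, on which the signs then
cancel. -/
theorem sum_stabilizer_sign {n : ℕ} {κ : Type} [DecidableEq κ] (u : Fin n → κ) :
    ∑ g ∈ Finset.univ.filter (fun g : Equiv.Perm (Fin n) => u ∘ g = u), signC g =
      if Function.Injective u then 1 else 0 := by
  split_ifs with h
  · have : (Finset.univ.filter fun g : Equiv.Perm (Fin n) => u ∘ g = u) = {1} := by
      ext g
      rw [Finset.mem_filter, Finset.mem_singleton]
      constructor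
      · rintro ⟨-, hg⟩
        ext x
        exact congrArg _ (h (congrFun hg x))
      · rintro rfl
        exact ⟨Finset.mem_univ _, rfl⟩
    rw [this, Finset.sum_singleton]
    simp [signC]
  · rw [Function.Injective] at h
    push Not at h
    obtain ⟨x, y, hxy, hne⟩ := h
    refine Finset.sum_involution (fun g _ => g * Equiv.swap x y) ?_ ?_ ?_ ?_
    · intro g _
      simp [signC, Equiv.Perm.sign_mul, Equiv.Perm.sign_swap hne]
    · intro g _ _ hg
      rw [mul_eq_left, Equiv.swap_eq_one_iff] at hg
      exact hne hg
    · intro g hg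
      rw [Finset.mem_filter] at hg ⊢
      refine ⟨Finset.mem_univ _, funext fun z => ?_⟩
      have h1 := congrFun hg.2
      simp only [Function.comp_apply] at h1
      rw [Function.comp_apply, Equiv.Perm.mul_apply, h1]
      by_cases hzx : z = x
      · rw [hzx, Equiv.swap_apply_left, hxy]
      · by_cases hzy : z = y
        · rw [hzy, Equiv.swap_apply_right, hxy]
        · rw [Equiv.swap_apply_of_ne_of_ne hzx hzy]
    · intro g _
      simp [mul_assoc]

/-- Words that are injective on every fibre of `u` contribute a product of elementary symmetric
polynomials. -/
theorem sum_pair_injective {n : ℕ} {κ : Type} [Fintype κ] [DecidableEq κ] (u : Fin n → κ) :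
    ∑ f ∈ Finset.univ.filter (fun f : Fin n → Fin n =>
        Function.Injective fun x => (u x, f x)), ∏ x, (X (f x) : MvPolynomial (Fin n) ℂ) =
      ∏ i, (((content u i).factorial : MvPolynomial (Fin n) ℂ) *
        esymm (Fin n) ℂ (content u i)) := by
  have h1 : ∀ i, content u i = Fintype.card {x // u x = i} := fun i => by
    rw [content, Fintype.card_subtype]
  simp only [h1, ← sum_injective_prod_X]
  rw [Finset.prod_univ_sum]
  refine Finset.sum_bij' (fun f _ => fun i x => f x.1) (fun h _ => fun x => h (u x) ⟨x, rfl⟩)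
    ?_ ?_ ?_ ?_ ?_
  · intro f hf
    rw [Finset.mem_filter] at hf
    rw [Fintype.mem_piFinset]
    intro i
    rw [Finset.mem_filter]
    refine ⟨Finset.mem_univ _, fun x y hxy => Subtype.ext (hf.2 ?_)⟩
    exact Prod.ext (x.2.trans y.2.symm) hxy
  · intro h hh
    rw [Fintype.mem_piFinset] at hh
    rw [Finset.mem_filter]
    refine ⟨Finset.mem_univ _, fun x y hxy => ?_⟩
    simp only [Prod.mk.injEq] at hxy
    have hy : h (u y) ⟨y, rfl⟩ = h (u x) ⟨y, hxy.1.symm⟩ := by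
      have : ∀ (j : κ) (hj : u y = j), h (u y) ⟨y, rfl⟩ = h j ⟨y, hj⟩ := by
        rintro j rfl; rfl
      exact this _ _
    have h3 := (Finset.mem_filter.1 (hh (u x))).2 (hxy.2.trans hy)
    exact congrArg Subtype.val h3
  · intro f _; rfl
  · intro h _
    funext i ⟨x, hx⟩
    subst hx
    rfl
  · intro f _
    rw [← Fintype.prod_sigma (fun y : Σ i, {x // u x = i} => (X (f y.2.1) : MvPolynomial (Fin n) ℂ))]
    exact (Equiv.prod_comp (Equiv.sigmaFiberEquiv u) (fun x => (X (f x) : MvPolynomial (Fin n) ℂ))).symm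

/-- Orbit counting for the words with a given content: their number is a multinomial
coefficient. -/
theorem card_words_mul_prod_factorial {n : ℕ} {κ : Type} [Fintype κ] [DecidableEq κ]
    (w : Fin n → κ) :
    (wordCount (content w) (1 : Equiv.Perm (Fin n))) * ∏ i, (content w i).factorial =
      n.factorial := by
  let H : Subgroup (Equiv.Perm (Fin n)) :=
    { carrier := {σ | w ∘ σ = w}
      one_mem' := rfl
      mul_mem' := fun {σ τ} hσ hτ => by
        change (w ∘ σ) ∘ τ = w
        rw [show w ∘ σ = w from hσ]; exact hτ
      inv_mem' := fun {σ} hσ => by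
        funext x
        have := congrFun (show w ∘ σ = w from hσ) (σ⁻¹ x)
        simpa using this.symm }
  have hH : ∀ σ, σ ∈ H ↔ w ∘ σ = w := fun σ => Iff.rfl
  have h1 := permChar_eq_wordCount w H hH 1
  have hcard : Nat.card H = ∏ i, (content w i).factorial := by
    have := DomMulAct.stabilizer_card (f := w)
    rw [← Nat.card_eq_fintype_card] at this
    refine Eq.trans this (Finset.prod_congr rfl fun i _ => ?_)
    rw [content, Fintype.card_subtype]
  have hne : (Nat.card H : ℂ) ≠ 0 := by exact_mod_cast Nat.card_pos.ne'
  rw [permChar, inducedFunction, inv_mul_eq_iff_eq_mul₀ hne] at h1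
  simp only [mul_one, inv_mul_cancel, H.one_mem, dite_true, Finset.sum_const, Finset.card_univ,
    Fintype.card_perm, Fintype.card_fin, nsmul_eq_mul] at h1
  rw [← hcard, mul_comm]
  exact_mod_cast h1.symm

/-- The twisted Frobenius characteristic of `φ_l` is `e_l`. -/
theorem twistedFrobenius_phi {n : ℕ} (l : n.Partition) :
    twistedFrobenius n (phi l).1 = esymmPart (Fin n) ℂ l := by
  have hne : (n.factorial : ℂ) ≠ 0 := by exact_mod_cast n.factorial_ne_zero
  rw [twistedFrobenius_apply, inv_smul_eq_iff₀ hne]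
  have hw : content (toComposition l).index = partFun l := content_index _
  -- both factors are sums over words, so their product is a sum over pairs of words
  have h1 : ∀ g : Equiv.Perm (Fin n), (signC g * (phi l).1 g) • wordPoly g =
      ∑ u ∈ Finset.univ.filter (fun u : Fin n → Fin (toComposition l).length =>
        content u = partFun l), ∑ f : Fin n → Fin n,
        (if (fun x => (u x, f x)) ∘ g = (fun x => (u x, f x)) then signC g else 0) •
          ∏ x, (X (f x) : MvPolynomial (Fin n) ℂ) := by
    intro g
    rw [phi_apply_partFun, wordCount, wordPoly, mul_comm, mul_smul, Nat.cast_smul_eq_nsmul,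
      ← Finset.sum_const, Finset.filter_and, Finset.inter_comm, ← Finset.filter_and,
      ← Finset.filter_filter, Finset.sum_filter]
    refine Finset.sum_congr rfl fun u _ => ?_
    split_ifs with hu
    · rw [Finset.smul_sum, Finset.sum_filter]
      refine Finset.sum_congr rfl fun f _ => ?_
      have : ((fun x => (u x, f x)) ∘ g = fun x => (u x, f x)) ↔ f ∘ g = f := by
        constructor
        · intro h; funext x; exact congrArg Prod.snd (congrFun h x)
        · intro h; funext x; exact Prod.ext (congrFun hu x) (congrFun h x)
      simp only [this]
      split_ifs <;> simp
    · symm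
      refine Finset.sum_eq_zero fun f _ => ?_
      rw [if_neg, zero_smul]
      intro h
      exact hu (funext fun x => congrArg Prod.fst (congrFun h x))
  rw [Finset.sum_congr rfl fun g _ => h1 g, Finset.sum_comm]
  have h2 : ∀ u ∈ Finset.univ.filter (fun u : Fin n → Fin (toComposition l).length =>
      content u = partFun l), (∑ g : Equiv.Perm (Fin n), ∑ f : Fin n → Fin n,
        (if (fun x => (u x, f x)) ∘ g = (fun x => (u x, f x)) then signC g else 0) •
          ∏ x, (X (f x) : MvPolynomial (Fin n) ℂ)) =
      ∏ i, (((partFun l i).factorial : MvPolynomial (Fin n) ℂ) *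
        esymm (Fin n) ℂ (partFun l i)) := by
    intro u hu
    rw [Finset.mem_filter] at hu
    rw [Finset.sum_comm, ← hu.2, ← sum_pair_injective, Finset.sum_filter]
    refine Finset.sum_congr rfl fun f _ => ?_
    rw [← Finset.sum_smul, ← Finset.sum_filter, sum_stabilizer_sign]
    split_ifs <;> simp
  rw [Finset.sum_congr rfl h2, Finset.sum_const, Finset.prod_mul_distrib]
  have h3 := card_words_mul_prod_factorial (toComposition l).index
  rw [hw, wordCount] at h3
  have h4 : ∏ i, esymm (Fin n) ℂ (partFun l i) = esymmPart (Fin n) ℂ l := by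
    rw [esymmPart]
    conv_rhs => rw [← map_blocksFun_toComposition l]
    rw [Multiset.map_map]
    rfl
  rw [h4, ← h3, nsmul_eq_mul, Algebra.smul_def]
  simp [mul_assoc]

/-- The twisted Frobenius characteristic is injective on class functions. -/
theorem eq_zero_of_twistedFrobenius_eq_zero {n : ℕ} {χ : Equiv.Perm (Fin n) → ℂ}
    (hχ : χ ∈ classFunctions (Equiv.Perm (Fin n))) (h : twistedFrobenius n χ = 0) : χ = 0 := by
  have hne : (n.factorial : ℂ) ≠ 0 := by exact_mod_cast n.factorial_ne_zero
  have h1 : ∀ l : n.Partition, ∑ g, signC g * χ g * (phi l).1 g = 0 := by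
    intro l
    have hlen : (toComposition l).length ≤ n := (toComposition l).length_le
    let e : Fin (toComposition l).length → Fin n := Fin.castLE hlen
    let d : Fin n → ℕ := fun i => if hi : (i : ℕ) < (toComposition l).length then
      partFun l ⟨i, hi⟩ else 0
    have h2 := coeff_twistedFrobenius χ (Finsupp.equivFunOnFinite.symm d)
    rw [h, coeff_zero, eq_comm, mul_eq_zero] at h2
    rw [← h2.resolve_left (inv_ne_zero hne)]
    refine Finset.sum_congr rfl fun g _ => ?_
    rw [phi_apply_partFun]
    congr 2
    refine wordCount_extend _ _ e (Fin.castLE_injective hlen) ?_ ?_ g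
    · intro k
      simp [d, e]
    · intro i hi
      simp only [Finsupp.coe_equivFunOnFinite_symm, d]
      rw [dif_neg]
      intro hi'
      exact hi ⟨⟨i, hi'⟩, rfl⟩
  -- the `φ_l` span the class functions, so `χ` is also orthogonal to itself
  let L : (Equiv.Perm (Fin n) → ℂ) →ₗ[ℂ] ℂ :=
    ∑ g, (signC g * χ g) • LinearMap.proj g
  have hL : ∀ ψ, L ψ = ∑ g, signC g * χ g * ψ g := by
    intro ψ
    simp [L, LinearMap.sum_apply]
  have h2 : ∀ ψ ∈ classFunctions (Equiv.Perm (Fin n)), L ψ = 0 := by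
    intro ψ hψ
    rw [← span_phi_eq_classFunctions] at hψ
    have : Submodule.span ℂ (Set.range fun l : n.Partition =>
        ((phi l).1 : Equiv.Perm (Fin n) → ℂ)) ≤ LinearMap.ker L := by
      rw [Submodule.span_le]
      rintro _ ⟨l, rfl⟩
      change L _ = 0
      rw [hL, h1]
    exact this hψ
  have h3 := h2 (fun g => starRingEnd ℂ (signC g * χ g)) (fun g k => by
    beta_reduce
    rw [hχ g k]
    simp only [signC]
    rw [Equiv.Perm.sign_mul, Equiv.Perm.sign_mul, Equiv.Perm.sign_inv, mul_right_comm,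
      Int.units_mul_self, one_mul])
  rw [hL] at h3
  simp only [Complex.mul_conj] at h3
  rw [← Complex.ofReal_sum, Complex.ofReal_eq_zero,
    Finset.sum_eq_zero_iff_of_nonneg (fun g _ => Complex.normSq_nonneg _)] at h3
  funext g
  have h4 := h3 g (Finset.mem_univ g)
  rw [Complex.normSq_eq_zero, mul_eq_zero] at h4
  refine h4.resolve_left ?_
  simp [signC]

/-- A virtual character and the integral combination of the `φ_l` with the same twisted Frobenius
characteristic are equal. -/
theorem span_phi_eq_top (n : ℕ) :
    Submodule.span ℤ (Set.range fun l : n.Partition => phi l) = ⊤ := by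
  rw [eq_top_iff]
  rintro ⟨χ, hχ⟩ -
  have h1 := mem_span_esymmPart _ (twistedFrobenius_isSymmetric χ)
    (twistedFrobenius_isHomogeneous χ) (exists_int_coeff_twistedFrobenius hχ)
  rw [Submodule.mem_span_range_iff_exists_fun] at h1 ⊢
  obtain ⟨a, ha⟩ := h1
  refine ⟨a, ?_⟩
  have h2 : ((∑ l, a l • phi l : R n) : Equiv.Perm (Fin n) → ℂ) - χ = 0 := by
    apply eq_zero_of_twistedFrobenius_eq_zero
    · exact virtualCharacter_mem_classFunctions (sub_mem (∑ l, a l • phi l : R n).2 hχ)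
    · rw [map_sub, ← ha, sub_eq_zero]
      rw [AddSubmonoidClass.coe_finsetSum, _root_.map_sum]
      refine Finset.sum_congr rfl fun l _ => ?_
      rw [← twistedFrobenius_phi, ← map_zsmul]
      rfl
  exact Subtype.ext (sub_eq_zero.1 h2)

/-- The permutation characters on the Young subgroups form a basis of the ring of virtual
characters. -/
noncomputable def phiBasis (n : ℕ) : Module.Basis n.Partition ℤ (R n) :=
  Module.Basis.mk (v := phi)
    (by
      rw [Fintype.linearIndependent_iff]
      intro a ha l
      have h := Fintype.linearIndependent_iff.1 (linearIndependent_phi n) (fun l => (a l : ℂ)) (by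
        have h1 := congrArg Subtype.val ha
        rw [AddSubmonoidClass.coe_finsetSum] at h1
        refine Eq.trans (Finset.sum_congr rfl fun l _ => ?_) h1
        rw [Int.cast_smul_eq_zsmul]
        rfl) l
      exact_mod_cast h)
    (span_phi_eq_top n).ge

theorem phiBasis_apply {n : ℕ} (l : n.Partition) : phiBasis n l = phi l := by
  simp [phiBasis]

/-- The elements `φ̄_l` form a basis of `R̄_n`. -/
noncomputable def phiBarBasis (p n : ℕ) : Module.Basis n.Partition (ZMod p) (RBar p n) :=
  Algebra.TensorProduct.basis (ZMod p) (phiBasis n)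

theorem phiBarBasis_apply (p : ℕ) {n : ℕ} (l : n.Partition) :
    phiBarBasis p n l = phiBar p l := by
  rw [phiBarBasis, Algebra.TensorProduct.basis_apply, phiBasis_apply]
  rfl

end Frobenius

/-! ### Multisets of block sizes -/

section Families

/-- The multiset of values of a finite family. -/
def famSet {ι : Type} [Fintype ι] (c : ι → ℕ) : Multiset ℕ := ∑ i, {c i}

theorem famSet_eq_map {ι : Type} [Fintype ι] (c : ι → ℕ) : famSet c = Finset.univ.val.map c := by
  rw [famSet, Finset.sum, ← Function.comp_def (fun a : ℕ => ({a} : Multiset ℕ)) c,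
    ← Multiset.map_map, Multiset.sum_map_singleton]

theorem exists_famSet_eq (m : Multiset ℕ) : ∃ (k : ℕ) (c : Fin k → ℕ), famSet c = m := by
  refine ⟨m.toList.length, m.toList.get, ?_⟩
  rw [famSet_eq_map, Fin.univ_val_map, List.ofFn_get, Multiset.coe_toList]

theorem sum_famSet {ι : Type} [Fintype ι] (c : ι → ℕ) : (famSet c).sum = ∑ i, c i := by
  rw [famSet_eq_map]; rfl

theorem mem_famSet {ι : Type} [Fintype ι] (c : ι → ℕ) (a : ℕ) :
    a ∈ famSet c ↔ ∃ i, c i = a := by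
  rw [famSet_eq_map]; simp

theorem card_famSet {ι : Type} [Fintype ι] (c : ι → ℕ) :
    (famSet c).card = Fintype.card ι := by
  rw [famSet_eq_map]; simp

/-- The number of nonzero members of a finite family. -/
def nonzeroCount {ι : Type} [Fintype ι] (c : ι → ℕ) : ℕ :=
  (Finset.univ.filter fun i => c i ≠ 0).card

theorem card_filter_famSet {ι : Type} [Fintype ι] (c : ι → ℕ) :
    ((famSet c).filter (· ≠ 0)).card = nonzeroCount c := by
  rw [famSet_eq_map, Multiset.filter_map, Multiset.card_map]
  rfl

theorem sum_filter_ne_zero (m : Multiset ℕ) : (m.filter (· ≠ 0)).sum = m.sum := by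
  conv_rhs => rw [← Multiset.filter_add_not (· ≠ 0) m, Multiset.sum_add]
  rw [Multiset.sum_eq_zero (s := m.filter fun a => ¬ a ≠ 0), add_zero]
  intro x hx
  have := Multiset.of_mem_filter hx
  simpa using this

theorem filter_nsmul_ne_zero (p : ℕ) (m : Multiset ℕ) :
    (p • m).filter (· ≠ 0) = p • m.filter (· ≠ 0) := by
  induction p with
  | zero => simp
  | succ p ih => rw [succ_nsmul, succ_nsmul, Multiset.filter_add, ih]

end Families

/-! ### Multiplication modulo `p` -/

section Hbar

/-- The permutation character of the Young subgroup whose block sizes are the members of `m`,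
modulo `p`; it is zero if the sum of `m` is not `n`. -/
noncomputable def youngBar (p n : ℕ) (m : Multiset ℕ) : RBar p n :=
  if h : m.sum = n then phiBar p (Nat.Partition.ofSums n m h) else 0

theorem youngBar_congr {p n : ℕ} {m m' : Multiset ℕ}
    (h : m.filter (· ≠ 0) = m'.filter (· ≠ 0)) : youngBar p n m = youngBar p n m' := by
  have hs : m.sum = m'.sum := by rw [← sum_filter_ne_zero m, h, sum_filter_ne_zero]
  unfold youngBar
  by_cases hm : m.sum = n
  · rw [dif_pos hm, dif_pos (hs ▸ hm)]
    congr 1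
    exact Nat.Partition.ext h
  · rw [dif_neg hm, dif_neg (hs ▸ hm)]

theorem youngBar_parts {p n : ℕ} (l : n.Partition) : youngBar p n l.parts = phiBar p l := by
  rw [youngBar, dif_pos l.parts_sum]
  congr 1
  apply Nat.Partition.ext
  exact Multiset.filter_eq_self.2 fun a ha => (l.parts_pos ha).ne'

theorem tmul_wordChar {p n : ℕ} {ι : Type} [Fintype ι] [DecidableEq ι] (c : ι → ℕ) :
    (1 ⊗ₜ[ℤ] wordChar n c : RBar p n) = youngBar p n (famSet c) := by
  rw [famSet_eq_map]
  unfold youngBar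
  split_ifs with h
  · rw [phiBar, wordChar_eq_phi c]
    rfl
  · have : wordChar n c = 0 := by
      apply Subtype.ext
      funext g
      rw [wordChar_apply, wordCount_eq_zero_of_sum_ne]
      · simp
      · rw [Fintype.card_fin]; exact h
    rw [this, TensorProduct.tmul_zero]

/-- The matrices with total sum `n` and prescribed row and column sums. -/
def marginMatrices (n : ℕ) {ι κ : Type} [Fintype ι] [DecidableEq ι] [Fintype κ] [DecidableEq κ]
    (c : ι → ℕ) (d : κ → ℕ) : Finset (ι × κ → ℕ) :=
  (Finset.piAntidiag (Finset.univ : Finset (ι × κ)) n).filter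
    fun M => (∀ i, ∑ j, M (i, j) = c i) ∧ ∀ j, ∑ i, M (i, j) = d j

theorem youngBar_mul {p n : ℕ} {ι κ : Type} [Fintype ι] [DecidableEq ι] [Fintype κ]
    [DecidableEq κ] (c : ι → ℕ) (d : κ → ℕ) :
    youngBar p n (famSet c) * youngBar p n (famSet d) =
      ∑ M ∈ marginMatrices n c d, youngBar p n (famSet M) := by
  rw [← tmul_wordChar, ← tmul_wordChar, Algebra.TensorProduct.tmul_mul_tmul, mul_one]
  have : wordChar n c * wordChar n d = ∑ M ∈ marginMatrices n c d, wordChar n M := by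
    apply Subtype.ext
    funext g
    rw [AddSubmonoidClass.coe_finsetSum, Finset.sum_apply]
    change (wordCount c g : ℂ) * wordCount d g =
      ∑ M ∈ marginMatrices n c d, (wordCount M g : ℂ)
    rw [← Nat.cast_mul, wordCount_mul, Fintype.card_fin, Nat.cast_sum]
    rfl
  rw [this, TensorProduct.tmul_sum]
  exact Finset.sum_congr rfl fun M _ => tmul_wordChar M

end Hbar

/-! ### Actions of `p`-groups -/

section PGroup

/-- Modulo `p`, a sum of an invariant function over a finite set acted on by a `p`-group reduces
to the fixed points. -/
theorem sum_eq_sum_fixedPoints {p : ℕ} [Fact p.Prime] {G X V : Type} [Group G] (hG : IsPGroup p G)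
    [Fintype X] [MulAction G X] [AddCommGroup V] [Module (ZMod p) V] (F : X → V)
    (hF : ∀ (g : G) x, F (g • x) = F x) [DecidablePred fun x : X => ∀ g : G, g • x = x] :
    ∑ x, F x = ∑ x ∈ Finset.univ.filter (fun x : X => ∀ g : G, g • x = x), F x := by
  classical
  rw [← Finset.sum_fiberwise_of_maps_to (s := Finset.univ) (t := Finset.univ.image F) (g := F)
    (fun x hx => Finset.mem_image_of_mem F hx)]
  rw [← Finset.sum_fiberwise_of_maps_to
    (s := Finset.univ.filter (fun x : X => ∀ g : G, g • x = x)) (t := Finset.univ.image F) (g := F)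
    (fun x _ => Finset.mem_image_of_mem F (Finset.mem_univ x))]
  refine Finset.sum_congr rfl fun v _ => ?_
  rw [Finset.sum_congr rfl (g := fun _ => v) (fun x hx => (Finset.mem_filter.1 hx).2),
    Finset.sum_congr rfl (g := fun _ => v) (fun x hx => (Finset.mem_filter.1 hx).2),
    Finset.sum_const, Finset.sum_const]
  let Y : SubMulAction G X := ⟨{x | F x = v}, fun g {x} hx => (hF g x).trans hx⟩
  have h := hG.card_modEq_card_fixedPoints (α := Y)
  have h1 : Nat.card Y = (Finset.univ.filter fun x => F x = v).card := by
    rw [← Fintype.card_subtype, ← Nat.card_eq_fintype_card]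
    rfl
  have h2 : Nat.card (MulAction.fixedPoints G Y) =
      ((Finset.univ.filter (fun x : X => ∀ g : G, g • x = x)).filter fun x => F x = v).card := by
    rw [← Fintype.card_coe, ← Nat.card_eq_fintype_card]
    refine Nat.card_congr
      { toFun := fun y => ⟨y.1.1, ?_⟩
        invFun := fun x => ⟨⟨x.1, ?_⟩, ?_⟩
        left_inv := fun _ => rfl
        right_inv := fun _ => rfl }
    · rw [Finset.mem_filter, Finset.mem_filter]
      exact ⟨⟨Finset.mem_univ _, fun g => congrArg Subtype.val (y.2 g)⟩, y.1.2⟩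
    · exact (Finset.mem_filter.1 x.2).2
    · intro g
      exact Subtype.ext ((Finset.mem_filter.1 (Finset.mem_filter.1 x.2).1).2 g)
  rw [h1, h2] at h
  rw [← Nat.cast_smul_eq_nsmul (ZMod p), ← Nat.cast_smul_eq_nsmul (ZMod p),
    (ZMod.natCast_eq_natCast_iff _ _ _).2 h]

end PGroup

/-! ### Matrices invariant under cyclic permutations -/

section CyclicBlocks

variable {p : ℕ} [Fact p.Prime] {A A' B' : Type} [Fintype A] [Fintype A'] [Fintype B']

/-- The matrix with rows `A ⊕ ZMod p` and columns `A' ⊕ (B' × ZMod p)` that is constant along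
the cyclic permutations of the rows `ZMod p` and of the columns `{b} × ZMod p`. -/
def cyclicMatrix (p : ℕ) (x : A × A' → ℕ) (y : A' → ℕ) (z : A × B' → ℕ) (w : B' → ℕ) :
    (A ⊕ ZMod p) × (A' ⊕ B' × ZMod p) → ℕ
  | (.inl a, .inl a') => x (a, a')
  | (.inr _, .inl a') => y a'
  | (.inl a, .inr (b, _)) => z (a, b)
  | (.inr _, .inr (b, _)) => w b

theorem famSet_cyclicMatrix (x : A × A' → ℕ) (y : A' → ℕ) (z : A × B' → ℕ) (w : B' → ℕ) :
    famSet (cyclicMatrix p x y z w) =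
      famSet x + p • (famSet y + famSet z + p • famSet w) := by
  simp only [famSet, Fintype.sum_prod_type, Fintype.sum_sum_type, cyclicMatrix, Finset.sum_const,
    Finset.card_univ, ZMod.card, Finset.sum_add_distrib, smul_add, Finset.smul_sum]
  abel

/-- Modulo `p`, only the matrices that are constant along the cycles contribute to a product of
two permutation characters. -/
theorem youngBar_mul_cyclic {n : ℕ} (γ : A → ℕ) (k : ℕ) (δ : A' → ℕ) (σ : B' → ℕ) :
    ∃ T : Finset ((A × A' → ℕ) × (A' → ℕ) × (A × B' → ℕ) × (B' → ℕ)),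
      youngBar p n (famSet γ + p • {k}) * youngBar p n (famSet δ + p • famSet σ) =
        ∑ t ∈ T, youngBar p n
          (famSet t.1 + p • (famSet t.2.1 + famSet t.2.2.1 + p • famSet t.2.2.2)) ∧
      ∀ x y z w, (x, y, z, w) ∈ T ↔
        (∑ a, γ a + p * k = n ∧ (∀ a, ∑ a', x (a, a') + p * ∑ b, z (a, b) = γ a) ∧
        (∑ a', y a' + p * ∑ b, w b = k) ∧ (∀ a', ∑ a, x (a, a') + p * y a' = δ a') ∧
        ∀ b, ∑ a, z (a, b) + p * w b = σ b) := by
  classical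
  let c : A ⊕ ZMod p → ℕ := Sum.elim γ fun _ => k
  let d : A' ⊕ B' × ZMod p → ℕ := Sum.elim δ fun q => σ q.1
  have hc : famSet c = famSet γ + p • {k} := by
    simp [famSet, c, Fintype.sum_sum_type, ZMod.card]
  have hd : famSet d = famSet δ + p • famSet σ := by
    simp [famSet, d, Fintype.sum_sum_type, Fintype.sum_prod_type, ZMod.card, Finset.smul_sum]
  let rowAct : Multiplicative (ZMod p) → A ⊕ ZMod p → A ⊕ ZMod p := fun s =>
    Sum.map id fun u => s.toAdd + u
  let colAct : (B' → Multiplicative (ZMod p)) → A' ⊕ B' × ZMod p → A' ⊕ B' × ZMod p := fun t =>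
    Sum.map id fun q => (q.1, (t q.1).toAdd + q.2)
  have row_one : ∀ i, rowAct 1 i = i := by
    rintro (a | u) <;> simp [rowAct]
  have col_one : ∀ j, colAct 1 j = j := by
    rintro (a | ⟨b, u⟩) <;> simp [colAct]
  have row_mul : ∀ s s' i, rowAct (s * s') i = rowAct s' (rowAct s i) := by
    rintro s s' (a | u)
    · simp [rowAct]
    · simp [rowAct]; ring
  have col_mul : ∀ t t' j, colAct (t * t') j = colAct t' (colAct t j) := by
    rintro t t' (a | ⟨b, u⟩)
    · simp [colAct]
    · simp [colAct]; ring
  let rowPerm : Multiplicative (ZMod p) → Equiv.Perm (A ⊕ ZMod p) := fun s =>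
    ⟨rowAct s, rowAct s⁻¹, fun i => by rw [← row_mul, mul_inv_cancel, row_one],
      fun i => by rw [← row_mul, inv_mul_cancel, row_one]⟩
  let colPerm : (B' → Multiplicative (ZMod p)) → Equiv.Perm (A' ⊕ B' × ZMod p) := fun t =>
    ⟨colAct t, colAct t⁻¹, fun i => by rw [← col_mul, mul_inv_cancel, col_one],
      fun i => by rw [← col_mul, inv_mul_cancel, col_one]⟩
  have hc_inv : ∀ s i, c (rowAct s i) = c i := by
    rintro s (a | u) <;> rfl
  have hd_inv : ∀ t j, d (colAct t j) = d j := by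
    rintro t (a | ⟨b, u⟩) <;> rfl
  let S := marginMatrices n c d
  have hS : ∀ M, M ∈ S ↔ (∑ q, M q = n) ∧ (∀ i, ∑ j, M (i, j) = c i) ∧
      ∀ j, ∑ i, M (i, j) = d j := by
    intro M
    simp [S, marginMatrices, Finset.mem_piAntidiag]
  let W := Multiplicative (ZMod p) × (B' → Multiplicative (ZMod p))
  have hact : ∀ (g : W) M, M ∈ S → (fun q => M (rowAct g.1 q.1, colAct g.2 q.2)) ∈ S := by
    intro g M hM
    rw [hS] at hM ⊢
    refine ⟨?_, fun i => ?_, fun j => ?_⟩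
    · rw [← hM.1]
      exact Equiv.sum_comp ((rowPerm g.1).prodCongr (colPerm g.2)) M
    · rw [← hc_inv g.1 i, ← hM.2.1]
      exact Equiv.sum_comp (colPerm g.2) fun j => M (rowAct g.1 i, j)
    · rw [← hd_inv g.2 j, ← hM.2.2]
      exact Equiv.sum_comp (rowPerm g.1) fun i => M (i, colAct g.2 j)
  let _ : MulAction W S :=
    { smul := fun g M => ⟨fun q => M.1 (rowAct g.1 q.1, colAct g.2 q.2), hact g M.1 M.2⟩
      one_smul := fun M => Subtype.ext (funext fun q => by
        change M.1 (rowAct 1 q.1, colAct 1 q.2) = _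
        rw [row_one, col_one])
      mul_smul := fun g h M => Subtype.ext (funext fun q => by
        change M.1 (rowAct (g.1 * h.1) q.1, colAct (g.2 * h.2) q.2) =
          M.1 (rowAct h.1 (rowAct g.1 q.1), colAct h.2 (colAct g.2 q.2))
        rw [row_mul, col_mul]) }
  have hW : IsPGroup p W := by
    apply IsPGroup.of_card (n := 1 + Fintype.card B')
    simp [W, pow_add]
  have hfix : ∀ M : S, (∀ g : W, g • M = M) ↔ ∃ t : (A × A' → ℕ) × (A' → ℕ) × (A × B' → ℕ) ×
      (B' → ℕ), cyclicMatrix p t.1 t.2.1 t.2.2.1 t.2.2.2 = M.1 := by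
    intro M
    constructor
    · intro h
      have h' : ∀ (g : W) q, M.1 (rowAct g.1 q.1, colAct g.2 q.2) = M.1 q := fun g q =>
        congrFun (congrArg Subtype.val (h g)) q
      refine ⟨(fun q => M.1 (.inl q.1, .inl q.2), fun a' => M.1 (.inr 0, .inl a'),
        fun q => M.1 (.inl q.1, .inr (q.2, 0)), fun b => M.1 (.inr 0, .inr (b, 0))), ?_⟩
      funext ⟨i, j⟩
      rcases i with a | u <;> rcases j with a' | ⟨b, v⟩
      · rfl
      · rw [← h' (1, fun _ => Multiplicative.ofAdd (-v)) (.inl a, .inr (b, v))]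
        simp [cyclicMatrix, rowAct, colAct]
      · rw [← h' (Multiplicative.ofAdd (-u), 1) (.inr u, .inl a')]
        simp [cyclicMatrix, rowAct, colAct]
      · rw [← h' (Multiplicative.ofAdd (-u), fun _ => Multiplicative.ofAdd (-v))
          (.inr u, .inr (b, v))]
        simp [cyclicMatrix, rowAct, colAct]
    · rintro ⟨t, ht⟩ g
      apply Subtype.ext
      change (fun q => M.1 (rowAct g.1 q.1, colAct g.2 q.2)) = M.1
      rw [← ht]
      funext ⟨i, j⟩
      rcases i with a | u <;> rcases j with a' | ⟨b, v⟩ <;> rfl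
  let Φ : (A × A' → ℕ) × (A' → ℕ) × (A × B' → ℕ) × (B' → ℕ) →
      ((A ⊕ ZMod p) × (A' ⊕ B' × ZMod p) → ℕ) :=
    fun t => cyclicMatrix p t.1 t.2.1 t.2.2.1 t.2.2.2
  have hΦ : Function.Injective Φ := by
    rintro ⟨x, y, z, w⟩ ⟨x', y', z', w'⟩ h
    have h' := congrFun h
    simp only [Prod.mk.injEq]
    exact ⟨funext fun q => h' (.inl q.1, .inl q.2), funext fun a' => h' (.inr 0, .inl a'),
      funext fun q => h' (.inl q.1, .inr (q.2, 0)), funext fun b => h' (.inr 0, .inr (b, 0))⟩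
  refine ⟨S.preimage Φ hΦ.injOn, ?_, ?_⟩
  · rw [← hc, ← hd, youngBar_mul]
    change ∑ M ∈ S, _ = _
    rw [← Finset.sum_coe_sort, sum_eq_sum_fixedPoints hW
      (fun M : S => youngBar p n (famSet M.1)) ?_]
    · symm
      refine Finset.sum_bij (fun t ht => ⟨Φ t, Finset.mem_preimage.1 ht⟩) ?_ ?_ ?_ ?_
      · intro t ht
        rw [Finset.mem_filter]
        exact ⟨Finset.mem_univ _, (hfix _).2 ⟨t, rfl⟩⟩
      · intro t _ t' _ h
        exact hΦ (congrArg Subtype.val h)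
      · intro M hM
        obtain ⟨t, ht⟩ := (hfix M).1 (Finset.mem_filter.1 hM).2
        refine ⟨t, Finset.mem_preimage.2 ?_, Subtype.ext ht⟩
        change cyclicMatrix p t.1 t.2.1 t.2.2.1 t.2.2.2 ∈ S
        rw [ht]
        exact M.2
      · intro t _
        rw [← famSet_cyclicMatrix]
    · intro g M
      congr 1
      exact Equiv.sum_comp ((rowPerm g.1).prodCongr (colPerm g.2)) (fun q => ({M.1 q} : Multiset ℕ))
  · intro x y z w
    rw [Finset.mem_preimage, hS]
    have htot : ∀ M : (A ⊕ ZMod p) × (A' ⊕ B' × ZMod p) → ℕ, (∀ i, ∑ j, M (i, j) = c i) →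
        ∑ q, M q = ∑ a, γ a + p * k := by
      intro M hM
      rw [Fintype.sum_prod_type, Finset.sum_congr rfl fun i _ => hM i, Fintype.sum_sum_type]
      simp [ZMod.card]
    have hrow : (∀ i, ∑ j, Φ (x, y, z, w) (i, j) = c i) ↔
        (∀ a, ∑ a', x (a, a') + p * ∑ b, z (a, b) = γ a) ∧ ∑ a', y a' + p * ∑ b, w b = k := by
      rw [Sum.forall]
      simp [Φ, c, cyclicMatrix, Fintype.sum_sum_type, Fintype.sum_prod_type, ZMod.card,
        Finset.mul_sum]
    have hcol : (∀ j, ∑ i, Φ (x, y, z, w) (i, j) = d j) ↔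
        (∀ a', ∑ a, x (a, a') + p * y a' = δ a') ∧ ∀ b, ∑ a, z (a, b) + p * w b = σ b := by
      rw [Sum.forall]
      simp [Φ, d, cyclicMatrix, Fintype.sum_sum_type, ZMod.card]
    constructor
    · rintro ⟨h1, h2, h3⟩
      rw [htot _ h2] at h1
      exact ⟨h1, (hrow.1 h2).1, (hrow.1 h2).2, hcol.1 h3⟩
    · rintro ⟨h1, h2, h3, h4⟩
      have h5 := hrow.2 ⟨h2, h3⟩
      exact ⟨(htot _ h5).trans h1, h5, hcol.2 h4⟩

end CyclicBlocks

/-! ### The spans of the `φ̄_l` with `π_p(l) ≥ i` -/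

section Levels

theorem card_eq_sum_count_Icc {n : ℕ} (m : Multiset ℕ) (h : ∀ k ∈ m, k ∈ Finset.Icc 1 n) :
    ∑ k ∈ Finset.Icc 1 n, m.count k = m.card :=
  Multiset.sum_count_eq_card h

/-- A partition containing `p` copies of a multiset `ρ` of positive integers satisfies
`π_p ≥ #ρ`. -/
theorem card_le_piP {p n : ℕ} (hp : 0 < p) (l : n.Partition) (γ ρ : Multiset ℕ)
    (hl : l.parts = γ + p • ρ) : ρ.card ≤ piP p l := by
  have hmem : ∀ k ∈ ρ, k ∈ l.parts := fun k hk => by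
    rw [hl]
    exact Multiset.mem_add.2 (Or.inr ((Multiset.mem_nsmul_of_ne_zero hp.ne').2 hk))
  rw [← card_eq_sum_count_Icc (n := n) ρ fun k hk => Finset.mem_Icc.2
    ⟨l.parts_pos (hmem k hk), l.le_of_mem_parts (hmem k hk)⟩, piP]
  refine Finset.sum_le_sum fun k _ => ?_
  rw [Nat.le_div_iff_mul_le hp, hl, Multiset.count_add, Multiset.count_nsmul, mul_comm]
  exact Nat.le_add_left _ _

/-- Every partition contains `p` copies of a multiset of `π_p` positive integers. -/
theorem exists_parts_eq_add_nsmul (p : ℕ) {n : ℕ} (l : n.Partition) :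
    ∃ γ ρ : Multiset ℕ, l.parts = γ + p • ρ ∧ ρ.card = piP p l ∧ ∀ k ∈ ρ, 0 < k := by
  let ρ : Multiset ℕ := ∑ k ∈ Finset.Icc 1 n, Multiset.replicate (l.parts.count k / p) k
  have hcount : ∀ k, ρ.count k = if k ∈ Finset.Icc 1 n then l.parts.count k / p else 0 := by
    intro k
    simp only [ρ, Multiset.count_sum', Multiset.count_replicate]
    rw [Finset.sum_ite_eq']
  have hle : p • ρ ≤ l.parts := by
    rw [Multiset.le_iff_count]
    intro k
    rw [Multiset.count_nsmul, hcount]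
    split_ifs
    · exact Nat.mul_div_le _ _
    · simp
  refine ⟨l.parts - p • ρ, ρ, (Multiset.sub_add_cancel hle).symm, ?_, ?_⟩
  · simp [ρ, piP, Multiset.card_sum]
  · intro k hk
    rw [Multiset.mem_sum] at hk
    obtain ⟨j, hj, hk⟩ := hk
    rw [Multiset.eq_of_mem_replicate hk]
    exact (Finset.mem_Icc.1 hj).1

/-- The span of the `φ̄_l` with `π_p(l) ≥ i`. -/
noncomputable def levelSpan (p n i : ℕ) : Submodule (ZMod p) (RBar p n) :=
  Submodule.span (ZMod p) {x | ∃ l : n.Partition, i ≤ piP p l ∧ phiBar p l = x}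

theorem phiBar_mem_levelSpan {p n i : ℕ} (l : n.Partition) (h : i ≤ piP p l) :
    phiBar p l ∈ levelSpan p n i :=
  Submodule.subset_span ⟨l, h, rfl⟩

theorem youngBar_eq_zero {p n : ℕ} {m : Multiset ℕ} (h : m.sum ≠ n) : youngBar p n m = 0 :=
  dif_neg h

/-- If a nonzero `youngBar` has `p` copies of a multiset with `i` nonzero members among its block
sizes, then it is some `φ̄_l` with `π_p(l) ≥ i`. -/
theorem youngBar_eq_phiBar {p n : ℕ} (hp : 0 < p) (γ ρ : Multiset ℕ)
    (h : (γ + p • ρ).sum = n) :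
    ∃ l : n.Partition, (ρ.filter (· ≠ 0)).card ≤ piP p l ∧
      youngBar p n (γ + p • ρ) = phiBar p l := by
  refine ⟨Nat.Partition.ofSums n _ h, ?_, dif_pos h⟩
  refine card_le_piP hp _ (γ.filter (· ≠ 0)) _ ?_
  rw [← filter_nsmul_ne_zero, ← Multiset.filter_add]
  rfl

theorem youngBar_mem_levelSpan {p n i : ℕ} (hp : 0 < p) (γ ρ : Multiset ℕ)
    (h : i ≤ (ρ.filter (· ≠ 0)).card) : youngBar p n (γ + p • ρ) ∈ levelSpan p n i := by
  by_cases hs : (γ + p • ρ).sum = n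
  · obtain ⟨l, hl, he⟩ := youngBar_eq_phiBar hp γ ρ hs
    rw [he]
    exact phiBar_mem_levelSpan l (h.trans hl)
  · rw [youngBar_eq_zero hs]
    exact zero_mem _

theorem levelSpan_zero (p n : ℕ) : levelSpan p n 0 = ⊤ := by
  rw [eq_top_iff, ← (phiBarBasis p n).span_eq, Submodule.span_le]
  rintro _ ⟨l, rfl⟩
  rw [phiBarBasis_apply]
  exact phiBar_mem_levelSpan l (Nat.zero_le _)

theorem piP_le {p n : ℕ} (hp : 0 < p) (l : n.Partition) : piP p l ≤ n := by
  obtain ⟨γ, ρ, h1, h2, h3⟩ := exists_parts_eq_add_nsmul p l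
  have h4 : ρ.card ≤ ρ.sum := by
    simpa using Multiset.card_nsmul_le_sum (s := ρ) (a := 1) (fun k hk => h3 k hk)
  have h5 := congrArg Multiset.sum h1
  rw [l.parts_sum, Multiset.sum_add, Multiset.sum_nsmul, smul_eq_mul] at h5
  have h6 : ρ.sum ≤ p * ρ.sum := Nat.le_mul_of_pos_left _ hp
  omega

theorem levelSpan_eq_bot {p n i : ℕ} (hp : 0 < p) (h : n < i) : levelSpan p n i = ⊥ := by
  rw [levelSpan, Submodule.span_eq_bot]
  rintro _ ⟨l, hl, -⟩
  exact absurd (piP_le hp l) (by omega)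

end Levels

/-! ### Counting orbits of nonzero entries -/

section Count

/-- The nonzero entries of the cyclic part of a matrix: every column cycle meets a nonzero
orbit of entries, and so does the row cycle; an orbit meeting both kinds has `p ^ 2` elements. -/
theorem card_add_one_le_nonzeroCount {p k : ℕ} (hp : 2 ≤ p) (hk : 0 < k) {A A' B' : Type}
    [Fintype A] [Fintype A'] [Fintype B'] (y : A' → ℕ) (z : A × B' → ℕ) (w σ : B' → ℕ)
    (hσ : ∀ b, 0 < σ b) (hy : ∑ a', y a' + p * ∑ b, w b = k)
    (hz : ∀ b, ∑ a, z (a, b) + p * w b = σ b) :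
    Fintype.card B' + 1 ≤ nonzeroCount y + nonzeroCount z + p * nonzeroCount w := by
  classical
  have h1 : Fintype.card B' ≤ nonzeroCount z + nonzeroCount w := by
    have hsub : (Finset.univ : Finset B') ⊆
        ((Finset.univ.filter fun q => z q ≠ 0).image Prod.snd) ∪
          Finset.univ.filter fun b => w b ≠ 0 := by
      intro b _
      rw [Finset.mem_union]
      by_cases hw : w b = 0
      · left
        have h2 := hz b
        rw [hw, mul_zero, add_zero] at h2
        have h3 : ∑ a, z (a, b) ≠ 0 := h2 ▸ (hσ b).ne'
        obtain ⟨a, -, ha⟩ := Finset.exists_ne_zero_of_sum_ne_zero h3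
        exact Finset.mem_image.2 ⟨(a, b), by simpa using ha, rfl⟩
      · right
        simpa using hw
    calc Fintype.card B' = (Finset.univ : Finset B').card := rfl
      _ ≤ _ := Finset.card_le_card hsub
      _ ≤ _ := Finset.card_union_le _ _
      _ ≤ _ := Nat.add_le_add_right Finset.card_image_le _
  by_cases hw : nonzeroCount w = 0
  · have hw0 : ∀ b, w b = 0 := by
      intro b
      by_contra hb
      rw [nonzeroCount, Finset.card_eq_zero, Finset.filter_eq_empty_iff] at hw
      exact hw (Finset.mem_univ b) hb
    have hy' : ∑ a', y a' ≠ 0 := by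
      simp only [hw0, Finset.sum_const_zero, mul_zero, add_zero] at hy
      omega
    obtain ⟨a', -, ha'⟩ := Finset.exists_ne_zero_of_sum_ne_zero hy'
    have : 0 < nonzeroCount y := Finset.card_pos.2 ⟨a', by simpa using ha'⟩
    rw [hw] at h1 ⊢
    omega
  · have : 2 * nonzeroCount w ≤ p * nonzeroCount w := Nat.mul_le_mul_right _ hp
    omega

theorem card_filter_cyclic {p : ℕ} {A A' B' : Type} [Fintype A] [Fintype A'] [Fintype B']
    (y : A' → ℕ) (z : A × B' → ℕ) (w : B' → ℕ) :
    ((famSet y + famSet z + p • famSet w).filter (· ≠ 0)).card =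
      nonzeroCount y + nonzeroCount z + p * nonzeroCount w := by
  rw [Multiset.filter_add, Multiset.filter_add, filter_nsmul_ne_zero, Multiset.card_add,
    Multiset.card_add, Multiset.card_nsmul, card_filter_famSet, card_filter_famSet,
    card_filter_famSet]

end Count

/-! ### Products and powers -/

section Products

variable {p : ℕ} [Fact p.Prime] {n : ℕ}

/-- One row cycle, from `l`, and the column cycles of `m` leave `π_p(m) + 1` groups of `p` equal
nonzero entries in each matrix that contributes to the product. -/
theorem phiBar_mul_mem_levelSpan {i : ℕ} (l m : n.Partition) (hl : 1 ≤ piP p l)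
    (hm : i ≤ piP p m) : phiBar p l * phiBar p m ∈ levelSpan p n (i + 1) := by
  have hp : p.Prime := Fact.out
  obtain ⟨γ, ρ, h1, h2, h3⟩ := exists_parts_eq_add_nsmul p l
  obtain ⟨δ, σ, h4, h5, h6⟩ := exists_parts_eq_add_nsmul p m
  obtain ⟨k, ρ', rfl⟩ : ∃ k ρ', ρ = k ::ₘ ρ' := by
    obtain ⟨k, hk⟩ := Multiset.card_pos_iff_exists_mem.1 (h2 ▸ hl : 0 < ρ.card)
    exact ⟨k, Multiset.exists_cons_of_mem hk⟩
  have hl' : l.parts = (γ + p • ρ') + p • {k} := by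
    rw [h1, ← Multiset.singleton_add, smul_add]
    abel
  obtain ⟨a, γ', hγ'⟩ := exists_famSet_eq (γ + p • ρ')
  obtain ⟨a', δ', hδ'⟩ := exists_famSet_eq δ
  obtain ⟨b, σ', hσ'⟩ := exists_famSet_eq σ
  rw [← youngBar_parts l, ← youngBar_parts m, hl', h4, ← hγ', ← hδ', ← hσ']
  obtain ⟨T, hT, hmem⟩ := youngBar_mul_cyclic (p := p) (n := n) γ' k δ' σ'
  rw [hT]
  refine Submodule.sum_mem _ ?_
  rintro ⟨x, y, z, w⟩ ht
  obtain ⟨-, -, hy, -, hz⟩ := (hmem x y z w).1 ht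
  refine youngBar_mem_levelSpan hp.pos _ _ ?_
  rw [card_filter_cyclic]
  have hk : 0 < k := h3 k (Multiset.mem_cons_self _ _)
  have hpos : ∀ j, 0 < σ' j := fun j => h6 _ (by rw [← hσ', mem_famSet]; exact ⟨j, rfl⟩)
  have := card_add_one_le_nonzeroCount hp.two_le hk y z w σ' hpos hy hz
  have hb : Fintype.card (Fin b) = piP p m := by rw [← h5, ← hσ', card_famSet]
  rw [hb] at this
  simp only
  omega

theorem mul_mem_levelSpan {i : ℕ} {u v : RBar p n} (hu : u ∈ levelSpan p n 1)
    (hv : v ∈ levelSpan p n i) : u * v ∈ levelSpan p n (i + 1) := by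
  induction hu using Submodule.span_induction with
  | mem u h =>
    obtain ⟨l, hl, rfl⟩ := h
    induction hv using Submodule.span_induction with
    | mem v h =>
      obtain ⟨m, hm, rfl⟩ := h
      exact phiBar_mul_mem_levelSpan l m hl hm
    | zero => rw [mul_zero]; exact zero_mem _
    | add a b _ _ ha hb => rw [mul_add]; exact add_mem ha hb
    | smul c a _ ha => rw [mul_smul_comm]; exact Submodule.smul_mem _ _ ha
  | zero => rw [zero_mul]; exact zero_mem _
  | add a b _ _ ha hb => rw [add_mul]; exact add_mem ha hb
  | smul c a _ ha => rw [smul_mul_assoc]; exact Submodule.smul_mem _ _ ha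

theorem isNilpotent_of_mem_levelSpan_one {u : RBar p n} (hu : u ∈ levelSpan p n 1) :
    IsNilpotent u := by
  have h : ∀ j, u ^ j ∈ levelSpan p n j := by
    intro j
    induction j with
    | zero => rw [levelSpan_zero]; trivial
    | succ j ih => rw [pow_succ']; exact mul_mem_levelSpan hu ih
  refine ⟨n + 1, ?_⟩
  have h1 := h (n + 1)
  rwa [levelSpan_eq_bot (Fact.out : p.Prime).pos (Nat.lt_succ_self n), Submodule.mem_bot] at h1

theorem exists_max_cons (m : Multiset ℕ) (a : ℕ) (ha : a ∈ m) :
    ∃ g m', m = g ::ₘ m' ∧ (∀ b ∈ m', b ≤ g) ∧ a ≤ g := by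
  obtain ⟨g, hg, hmax⟩ := Finset.exists_max_image m.toFinset id ⟨a, Multiset.mem_toFinset.2 ha⟩
  obtain ⟨m', rfl⟩ := Multiset.exists_cons_of_mem (Multiset.mem_toFinset.1 hg)
  exact ⟨g, m', rfl, fun b hb => hmax b (Multiset.mem_toFinset.2 (Multiset.mem_cons_of_mem hb)),
    hmax a (Multiset.mem_toFinset.2 ha)⟩

theorem famSet_option {ι : Type} [Fintype ι] (c : Option ι → ℕ) :
    famSet c = c none ::ₘ famSet fun i => c (some i) := by
  rw [famSet, Fintype.sum_option, Multiset.singleton_add]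
  rfl

theorem famSet_unit_prod {ι : Type} [Fintype ι] (c : Unit × ι → ℕ) :
    famSet c = famSet fun i => c ((), i) := by
  rw [famSet, Fintype.sum_prod_type]
  simp [famSet]

/-- The inductive step for `L_{i+1} ⊆ I ^ (i + 1)`. For `ρ = (k, ρ₁)`, the class of
`(g, γ, p·ρ)` is the leading term of the product of `φ̄_(n - pk, k, …, k)`, which lies in `I`, with the
class of `(g + pk, γ, p·ρ₁)`, which lies in `I ^ i`. The other terms `(g', γ', p·ρ')` come first in
the lexicographic induction: `ρ'` is longer, or as long with a smaller sum, or as long with the same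
sum and `g' > g`. -/
theorem youngBar_mem_pow_of_lower (I : Ideal (RBar p n)) (i : ℕ)
    (hI : ∀ l : n.Partition, 1 ≤ piP p l → phiBar p l ∈ I)
    (hi : ∀ l : n.Partition, i ≤ piP p l → phiBar p l ∈ I ^ i)
    (t : ℕ ×ₗ ℕ ×ₗ ℕ) : ∀ (g : ℕ) (γ ρ : Multiset ℕ), (∀ a ∈ γ, a ≤ g) → (∀ k ∈ ρ, 0 < k) →
      i + 1 ≤ ρ.card → toLex (n - ρ.card, toLex (ρ.sum, n - g)) = t →
      youngBar p n (g ::ₘ γ + p • ρ) ∈ I ^ (i + 1) := by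
  classical
  have hp : p.Prime := Fact.out
  induction t using WellFoundedLT.induction with
  | ind t ih =>
  intro g γ ρ hγ hρ hcard ht
  by_cases hsum : (g ::ₘ γ + p • ρ).sum = n
  swap
  · rw [youngBar_eq_zero hsum]; exact zero_mem _
  obtain ⟨k, hk⟩ := Multiset.card_pos_iff_exists_mem.1 (by omega : 0 < ρ.card)
  obtain ⟨ρ₁, rfl⟩ := Multiset.exists_cons_of_mem hk
  have hk0 : 0 < k := hρ k hk
  have hρ₁ : ∀ a ∈ ρ₁, 0 < a := fun a ha => hρ a (Multiset.mem_cons_of_mem ha)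
  rw [Multiset.card_cons] at hcard
  have hρ₁f : ρ₁.filter (· ≠ 0) = ρ₁ := Multiset.filter_eq_self.2 fun a ha => (hρ₁ a ha).ne'
  obtain ⟨s, γ', rfl⟩ := exists_famSet_eq γ
  obtain ⟨r, σ, rfl⟩ := exists_famSet_eq ρ₁
  have hσ : ∀ b, 0 < σ b := fun b => hρ₁ _ ((mem_famSet _ _).2 ⟨b, rfl⟩)
  rw [card_famSet, Fintype.card_fin] at hcard
  -- numerical consequences of the total degree being `n`
  have hsum' : g + ∑ a, γ' a + p * (k + ∑ b, σ b) = n := by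
    rw [← hsum, Multiset.sum_add, Multiset.sum_nsmul, Multiset.sum_cons, Multiset.sum_cons,
      sum_famSet, sum_famSet, smul_eq_mul]
  have hrσ : r ≤ ∑ b, σ b := by
    calc r = ∑ _b : Fin r, 1 := by simp
      _ ≤ _ := Finset.sum_le_sum fun b _ => hσ b
  have hpk : 2 * (k + ∑ b, σ b) ≤ p * (k + ∑ b, σ b) := Nat.mul_le_mul_right _ hp.two_le
  have hpk' : p * (k + ∑ b, σ b) = p * k + p * ∑ b, σ b := mul_add _ _ _
  have hpk0 : 0 < p * k := Nat.mul_pos hp.pos hk0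
  let δ : Option (Fin s) → ℕ := fun o => o.elim (g + p * k) γ'
  obtain ⟨T, hT, hmem⟩ := youngBar_mul_cyclic (p := p) (n := n)
    (fun _ : Unit => n - p * k) k δ σ
  have hprod : youngBar p n (famSet (fun _ : Unit => n - p * k) + p • {k}) *
      youngBar p n (famSet δ + p • famSet σ) ∈ I ^ (i + 1) := by
    have hpow : I ^ (i + 1) = I * I ^ i := pow_succ' I i
    rw [hpow]
    refine Ideal.mul_mem_mul ?_ ?_
    · obtain ⟨l, hl, he⟩ := youngBar_eq_phiBar (n := n) hp.pos (famSet fun _ : Unit => n - p * k)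
        {k} (by
          rw [Multiset.sum_add, Multiset.sum_nsmul, sum_famSet, Multiset.sum_singleton,
            smul_eq_mul]
          simp only [Finset.univ_unique, Finset.sum_const, Finset.card_singleton, one_smul]
          omega)
      rw [he]
      refine hI l (le_trans ?_ hl)
      rw [Multiset.filter_singleton, if_pos hk0.ne', Multiset.card_singleton]
    · obtain ⟨l, hl, he⟩ := youngBar_eq_phiBar (n := n) hp.pos (famSet δ) (famSet σ) (by
          rw [Multiset.sum_add, Multiset.sum_nsmul, sum_famSet, sum_famSet, smul_eq_mul,
            Fintype.sum_option]
          simp only [δ, Option.elim]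
          omega)
      rw [he]
      refine hi l (le_trans ?_ hl)
      rw [hρ₁f, card_famSet, Fintype.card_fin]
      omega
  rw [hT] at hprod
  -- the leading term: the row cycle meets only the column of `g + pk`, where it puts all of `k`
  let x₀ : Unit × Option (Fin s) → ℕ := fun q => q.2.elim g γ'
  let y₀ : Option (Fin s) → ℕ := fun o => o.elim k fun _ => 0
  let z₀ : Unit × Fin r → ℕ := fun q => σ q.2
  have h₀ : (x₀, y₀, z₀, fun _ => 0) ∈ T := by
    rw [hmem]
    refine ⟨?_, ?_, ?_, ?_, ?_⟩
    · simp only [Finset.univ_unique, Finset.sum_const, Finset.card_singleton, one_smul]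
      omega
    · intro _
      simp only [x₀, z₀, Fintype.sum_option, Option.elim]
      omega
    · simp [y₀, Fintype.sum_option]
    · rintro (_ | a)
      · simp [x₀, y₀, δ]
      · simp [x₀, y₀, δ]
    · intro b
      simp [z₀]
  rw [← Finset.add_sum_erase _ _ h₀] at hprod
  have hmain : youngBar p n (famSet x₀ + p • (famSet y₀ + famSet z₀ +
      p • famSet fun _ : Fin r => 0)) = youngBar p n (g ::ₘ famSet γ' + p • (k ::ₘ famSet σ)) := by
    apply youngBar_congr
    rw [Multiset.filter_add, Multiset.filter_add, filter_nsmul_ne_zero, filter_nsmul_ne_zero,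
      famSet_unit_prod x₀, famSet_unit_prod z₀, famSet_option, famSet_option]
    congr 2
    have hzero : ∀ (ι : Type) [Fintype ι], (famSet fun _ : ι => 0).filter (· ≠ 0) = 0 := by
      intro ι _
      rw [Multiset.filter_eq_nil]
      intro a ha
      obtain ⟨_, rfl⟩ := (mem_famSet _ _).1 ha
      simp
    simp only [Multiset.filter_add, filter_nsmul_ne_zero, y₀, z₀, Option.elim]
    have hcons : ∀ m : Multiset ℕ, (k ::ₘ m).filter (· ≠ 0) = k ::ₘ m.filter (· ≠ 0) :=
      fun m => Multiset.filter_cons_of_pos m hk0.ne'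
    rw [hzero, smul_zero, add_zero, hcons, hcons, hzero, Multiset.cons_add, zero_add]
  rw [← hmain]
  refine (Submodule.add_mem_iff_left _ (Submodule.sum_mem _ ?_)).1 hprod
  rintro ⟨x, y, z, w⟩ hq
  rw [Finset.mem_erase] at hq
  obtain ⟨hne, hq⟩ := hq
  obtain ⟨-, -, hy, hx, hz⟩ := (hmem x y z w).1 hq
  have hlevel := card_add_one_le_nonzeroCount hp.two_le hk0 y z w σ hσ hy hz
  replace hx : ∀ o, x ((), o) + p * y o = δ o := fun o =>
    (congrArg (· + p * y o) (Fintype.sum_unique fun a => x (a, o))).symm.trans (hx o)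
  replace hz : ∀ b, z ((), b) + p * w b = σ b := fun b =>
    (congrArg (· + p * w b) (Fintype.sum_unique fun a => z (a, b))).symm.trans (hz b)
  rw [Fintype.card_fin] at hlevel
  let ρ' := (famSet y + famSet z + p • famSet w).filter (· ≠ 0)
  have hρ'card : ρ'.card = nonzeroCount y + nonzeroCount z + p * nonzeroCount w :=
    card_filter_cyclic y z w
  have hρ'sum : ρ'.sum + p * ∑ b, w b = k + ∑ b, σ b := by
    have h1 : ∑ b, σ b = ∑ b, z ((), b) + p * ∑ b, w b := by
      rw [Finset.mul_sum, ← Finset.sum_add_distrib]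
      exact Finset.sum_congr rfl fun b _ => (hz b).symm
    have h2 : ∑ q, z q = ∑ b, z ((), b) :=
      (Fintype.sum_prod_type z).trans (Fintype.sum_unique _)
    rw [sum_filter_ne_zero, Multiset.sum_add, Multiset.sum_add, Multiset.sum_nsmul, sum_famSet,
      sum_famSet, sum_famSet, smul_eq_mul]
    omega
  obtain ⟨g', γ'', hg, hmax, hle⟩ := exists_max_cons (famSet x) (x ((), none))
    ((mem_famSet _ _).2 ⟨_, rfl⟩)
  have hrew : youngBar p n (famSet x + p • (famSet y + famSet z + p • famSet w)) =
      youngBar p n (g' ::ₘ γ'' + p • ρ') := by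
    apply youngBar_congr
    rw [← hg, Multiset.filter_add, Multiset.filter_add, filter_nsmul_ne_zero,
      filter_nsmul_ne_zero]
    congr 2
    exact (Multiset.filter_eq_self.2 fun a ha => Multiset.of_mem_filter ha).symm
  change youngBar p n (famSet x + p • (famSet y + famSet z + p • famSet w)) ∈ _
  rw [hrew]
  refine ih _ ?_ g' γ'' ρ' hmax
    (fun a ha => Nat.pos_of_ne_zero (Multiset.of_mem_filter (p := (· ≠ 0)) ha)) (by omega) rfl
  rw [← ht, Multiset.card_cons, card_famSet, Fintype.card_fin, Multiset.sum_cons, sum_famSet]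
  simp only [Prod.Lex.toLex_lt_toLex]
  -- the number of cyclic parts increases, or the sum of the cyclic parts decreases, or the
  -- largest remaining part increases
  have hcases : r + 2 ≤ ρ'.card ∨ 0 < ∑ b, w b ∨ (y none = 0 ∧ ∑ b, w b = 0) := by
    by_cases hw : ∑ b, w b = 0
    swap
    · right; left; omega
    by_cases hy0 : y none = 0
    · right; right; exact ⟨hy0, hw⟩
    left
    have hw0 : w = fun _ => 0 := by
      funext b
      exact (Finset.sum_eq_zero_iff.1 hw) b (Finset.mem_univ b)
    have hz0 : z = z₀ := by
      funext ⟨_, b⟩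
      have := hz b
      rw [hw0, mul_zero, add_zero] at this
      exact this
    have hzc : nonzeroCount z = r := by
      rw [hz0, nonzeroCount, Finset.filter_true_of_mem fun q _ => (hσ q.2).ne']
      simp
    -- a second nonzero entry, as otherwise the matrix is the leading one
    have hex : ∃ a, y (some a) ≠ 0 := by
      by_contra hall
      push Not at hall
      apply hne
      rw [hw, mul_zero, add_zero, Fintype.sum_option, Finset.sum_eq_zero fun a _ => hall a,
        add_zero] at hy
      have hyy : y = y₀ := by
        funext o
        cases o with
        | none => exact hy
        | some a => exact hall a
      have hxx : x = x₀ := by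
        funext ⟨_, o⟩
        have h1 := hx o
        rw [hyy] at h1
        cases o with
        | none =>
          simp only [y₀, δ, Option.elim] at h1
          simp only [x₀, Option.elim]
          exact Nat.add_right_cancel h1
        | some a =>
          simp only [y₀, δ, Option.elim] at h1
          simpa [x₀] using h1
      rw [hxx, hyy, hz0, hw0]
    obtain ⟨a, ha⟩ := hex
    have hyc : 2 ≤ nonzeroCount y := by
      have hsub : ({none, some a} : Finset (Option (Fin s))) ⊆
          Finset.univ.filter fun o => y o ≠ 0 := by
        intro o ho
        rw [Finset.mem_insert, Finset.mem_singleton] at ho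
        rw [Finset.mem_filter]
        rcases ho with rfl | rfl
        · exact ⟨Finset.mem_univ _, hy0⟩
        · exact ⟨Finset.mem_univ _, ha⟩
      have := Finset.card_le_card hsub
      rwa [Finset.card_pair (by simp)] at this
    rw [hρ'card, hzc]
    omega
  rcases hcases with h | h | ⟨h, hw⟩
  · left
    omega
  · have : 0 < p * ∑ b, w b := Nat.mul_pos hp.pos h
    by_cases hc : n - ρ'.card < n - (r + 1)
    · left; exact hc
    · right
      exact ⟨by omega, Or.inl (by omega)⟩
  · have h1 := hx none
    rw [h, mul_zero, add_zero] at h1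
    simp only [δ, Option.elim] at h1
    rw [hw, mul_zero, add_zero] at hρ'sum
    by_cases hc : n - ρ'.card < n - (r + 1)
    · left; exact hc
    · right
      exact ⟨by omega, Or.inr ⟨hρ'sum, by omega⟩⟩

/-- An ideal containing all the `φ̄_l` with `π_p(l) ≥ 1` has powers containing all the `φ̄_l` with
`π_p(l) ≥ i`. -/
theorem phiBar_mem_pow (I : Ideal (RBar p n))
    (hI : ∀ l : n.Partition, 1 ≤ piP p l → phiBar p l ∈ I) (i : ℕ) :
    ∀ l : n.Partition, i ≤ piP p l → phiBar p l ∈ I ^ i := by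
  induction i with
  | zero =>
    intro l _
    have hpow : I ^ 0 = 1 := pow_zero I
    rw [hpow, Ideal.one_eq_top]
    trivial
  | succ i ih =>
    intro l hl
    obtain ⟨γ, ρ, h1, h2, h3⟩ := exists_parts_eq_add_nsmul p l
    -- a zero is added so that there is a largest member even if `γ` is empty
    obtain ⟨g, γ', hg, hmax, -⟩ := exists_max_cons (0 ::ₘ γ) 0 (Multiset.mem_cons_self _ _)
    have h4 : phiBar p l = youngBar p n (g ::ₘ γ' + p • ρ) := by
      rw [← youngBar_parts, h1, ← hg]
      apply youngBar_congr
      rw [Multiset.cons_add, Multiset.filter_cons_of_neg _ (by simp)]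
    rw [h4]
    exact youngBar_mem_pow_of_lower I i hI ih _ g γ' ρ hmax h3 (h2 ▸ hl) rfl

end Products

/-! ### Evaluation modulo `p` -/

section Evaluation

variable {p : ℕ} [Fact p.Prime] {n : ℕ}

theorem exists_int_eval (g : Equiv.Perm (Fin n)) (χ : R n) : ∃ a : ℤ, (a : ℂ) = χ.1 g := by
  have h : χ ∈ Submodule.span ℤ (Set.range fun l : n.Partition => phi l) := by
    rw [span_phi_eq_top]; trivial
  induction h using Submodule.span_induction with
  | mem χ h =>
    obtain ⟨l, rfl⟩ := h
    exact ⟨_, by rw [phi_apply_partFun, Int.cast_natCast]⟩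
  | zero => exact ⟨0, by rw [Int.cast_zero]; rfl⟩
  | add a b _ _ ha hb =>
    obtain ⟨i, hi⟩ := ha
    obtain ⟨j, hj⟩ := hb
    exact ⟨i + j, by rw [Int.cast_add, hi, hj]; rfl⟩
  | smul c a _ ha =>
    obtain ⟨i, hi⟩ := ha
    refine ⟨c * i, ?_⟩
    rw [Int.cast_mul, hi]
    exact (zsmul_eq_mul (a.1 g) c).symm

/-- Evaluation of virtual characters of the symmetric group, which are integer valued. -/
noncomputable def evalInt (g : Equiv.Perm (Fin n)) : R n →+* ℤ where
  toFun χ := (exists_int_eval g χ).choose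
  map_one' := Int.cast_injective (α := ℂ) (by
    rw [(exists_int_eval g 1).choose_spec, Int.cast_one]; rfl)
  map_zero' := Int.cast_injective (α := ℂ) (by
    rw [(exists_int_eval g 0).choose_spec, Int.cast_zero]; rfl)
  map_mul' χ ψ := Int.cast_injective (α := ℂ) (by
    rw [(exists_int_eval g (χ * ψ)).choose_spec, Int.cast_mul, (exists_int_eval g χ).choose_spec,
      (exists_int_eval g ψ).choose_spec]; rfl)
  map_add' χ ψ := Int.cast_injective (α := ℂ) (by
    rw [(exists_int_eval g (χ + ψ)).choose_spec, Int.cast_add, (exists_int_eval g χ).choose_spec,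
      (exists_int_eval g ψ).choose_spec]; rfl)

theorem evalInt_phi (g : Equiv.Perm (Fin n)) (l : n.Partition) :
    evalInt g (phi l) = wordCount (partFun l) g := by
  apply Int.cast_injective (α := ℂ)
  rw [Int.cast_natCast, ← phi_apply_partFun]
  exact (exists_int_eval g (phi l)).choose_spec

/-- Evaluation at a permutation, modulo `p`. -/
noncomputable def evalBar (p : ℕ) [Fact p.Prime] (g : Equiv.Perm (Fin n)) :
    RBar p n →ₐ[ZMod p] ZMod p :=
  Algebra.TensorProduct.lift (AlgHom.id (ZMod p) (ZMod p))
    ((Int.castRingHom (ZMod p)).comp (evalInt g)).toIntAlgHom fun _ _ => Commute.all _ _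

theorem evalBar_phiBar (g : Equiv.Perm (Fin n)) (l : n.Partition) :
    evalBar p g (phiBar p l) = wordCount (partFun l) g := by
  rw [evalBar, phiBar, Algebra.TensorProduct.lift_tmul]
  change (1 : ZMod p) * ((evalInt g (phi l) : ℤ) : ZMod p) = _
  rw [evalInt_phi, one_mul, Int.cast_natCast]

/-- The kernel of evaluation is a maximal ideal. -/
theorem evalBar_eq_zero_of_mem_jacobson (g : Equiv.Perm (Fin n)) {u : RBar p n}
    (hu : u ∈ Ring.jacobson (RBar p n)) : evalBar p g u = 0 := by
  have hs : Function.Surjective (evalBar p g : RBar p n →+* ZMod p) := fun a =>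
    ⟨algebraMap _ _ a, (evalBar p g).commutes a⟩
  have : (RingHom.ker (evalBar p g : RBar p n →+* ZMod p)).IsMaximal :=
    RingHom.ker_isMaximal_of_surjective _ hs
  exact Ring.jacobson_le_of_isMaximal (RingHom.ker (evalBar p g : RBar p n →+* ZMod p)) hu

end Evaluation

/-! ### The radical and its powers -/

section Radical

variable {p : ℕ} [Fact p.Prime] {n : ℕ}

theorem mem_jacobson_of_isNilpotent {S : Type} [CommRing S] {u : S} (hu : IsNilpotent u) :
    u ∈ Ring.jacobson S := by
  rw [Ring.jacobson_eq_sInf_isMaximal, Submodule.mem_sInf]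
  intro M hM
  have : Ideal.IsMaximal M := hM
  obtain ⟨j, hj⟩ := hu
  exact this.isPrime.mem_of_pow_mem j (hj ▸ M.zero_mem)

theorem levelSpan_one_le_jacobson {u : RBar p n} (hu : u ∈ levelSpan p n 1) :
    u ∈ Ring.jacobson (RBar p n) :=
  mem_jacobson_of_isNilpotent (isNilpotent_of_mem_levelSpan_one hu)

theorem one_le_piP_iff_isPSingular (l : n.Partition) : 1 ≤ piP p l ↔ IsPSingular p l := by
  have hp : p.Prime := Fact.out
  constructor
  · intro h
    by_contra hs
    have : piP p l = 0 := Finset.sum_eq_zero fun k _ =>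
      Nat.div_eq_of_lt (not_le.1 fun hk => hs ⟨k, hk⟩)
    omega
  · rintro ⟨k, hk⟩
    have := card_le_piP hp.pos l (l.parts - Multiset.replicate p k) {k} (by
      rw [Multiset.nsmul_singleton,
        Multiset.sub_add_cancel (Multiset.le_count_iff_replicate_le.1 hk)])
    simpa using this

/-- If `π_p(l) = 0`, the value of `φ_l` at a permutation of cycle type `l` is prime to `p`. -/
theorem prod_factorial_ne_zero (l : n.Partition) (hl : ¬ 1 ≤ piP p l) :
    ((∏ k ∈ l.parts.toFinset, (l.parts.count k).factorial : ℕ) : ZMod p) ≠ 0 := by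
  have hp : p.Prime := Fact.out
  rw [Ne, ZMod.natCast_eq_zero_iff, hp.prime.dvd_finsetProd_iff]
  rintro ⟨k, -, hd⟩
  rw [hp.dvd_factorial] at hd
  exact hl ((one_le_piP_iff_isPSingular l).2 ⟨k, hd⟩)

/-- Modulo `L_1`, an element of the radical is a combination of the `φ̄_l` with `π_p(l) = 0`; all of
its values vanish modulo `p`, so triangularity applies. -/
theorem jacobson_le_levelSpan_one {u : RBar p n} (hu : u ∈ Ring.jacobson (RBar p n)) :
    u ∈ levelSpan p n 1 := by
  classical
  let a : n.Partition → ZMod p := fun l => (phiBarBasis p n).repr u l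
  have hua : u = ∑ l, a l • phiBar p l := by
    conv_lhs => rw [← (phiBarBasis p n).sum_repr u]
    exact Finset.sum_congr rfl fun l _ => by rw [phiBarBasis_apply]
  let b : n.Partition → ZMod p := fun l => if 1 ≤ piP p l then 0 else a l
  let v : RBar p n := ∑ l, (if 1 ≤ piP p l then a l else 0) • phiBar p l
  have hv : v ∈ levelSpan p n 1 := by
    refine Submodule.sum_mem _ fun l _ => ?_
    split_ifs with h
    · exact Submodule.smul_mem _ _ (phiBar_mem_levelSpan l h)
    · rw [zero_smul]; exact zero_mem _
  have huv : u = v + ∑ l, b l • phiBar p l := by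
    rw [hua, ← Finset.sum_add_distrib]
    refine Finset.sum_congr rfl fun l _ => ?_
    simp only [b]
    split_ifs
    · rw [zero_smul, add_zero]
    · rw [zero_smul, zero_add]
  have hb : b = 0 := by
    refine coeff_eq_zero_of_sum_wordCount b (fun l hl => ?_) fun l _ => ?_
    · refine prod_factorial_ne_zero l fun h => hl ?_
      simp [b, h]
    · have h1 := evalBar_eq_zero_of_mem_jacobson (permOfPartition l) hu
      rw [huv, map_add,
        evalBar_eq_zero_of_mem_jacobson (permOfPartition l) (levelSpan_one_le_jacobson hv),
        zero_add, map_sum] at h1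
      rw [← h1]
      refine Finset.sum_congr rfl fun m _ => ?_
      rw [map_smul, evalBar_phiBar, smul_eq_mul]
  rw [huv, hb]
  simpa using hv

theorem mem_jacobson_iff {u : RBar p n} :
    u ∈ Ring.jacobson (RBar p n) ↔ u ∈ levelSpan p n 1 :=
  ⟨jacobson_le_levelSpan_one, levelSpan_one_le_jacobson⟩

theorem mem_levelSpan_of_mem_jacobson_pow (i : ℕ) {u : RBar p n}
    (hu : u ∈ Ring.jacobson (RBar p n) ^ i) : u ∈ levelSpan p n i := by
  induction i generalizing u with
  | zero => rw [levelSpan_zero]; trivial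
  | succ i ih =>
    have hpow : ∀ I : Ideal (RBar p n), I ^ (i + 1) = I * I ^ i := fun I => pow_succ' I i
    rw [hpow] at hu
    induction hu using Submodule.mul_induction_on' with
    | mem_mul_mem a ha b hb => exact mul_mem_levelSpan (mem_jacobson_iff.1 ha) (ih hb)
    | add a _ b _ ha hb => exact add_mem ha hb

theorem jacobson_pow_eq_levelSpan (i : ℕ) :
    (Ring.jacobson (RBar p n) ^ i).restrictScalars (ZMod p) = levelSpan p n i := by
  apply le_antisymm
  · intro u hu
    exact mem_levelSpan_of_mem_jacobson_pow i hu
  · rw [levelSpan, Submodule.span_le]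
    rintro _ ⟨l, hl, rfl⟩
    exact phiBar_mem_pow (Ring.jacobson (RBar p n))
      (fun l hl => levelSpan_one_le_jacobson (phiBar_mem_levelSpan l hl)) i l hl

end Radical

end SymGrothendieck

/-- The powers of the Jacobson radical of the mod-`p` ring of virtual characters of the
symmetric group, as a direct sum of lines. -/
theorem theoremA (p : ℕ) [Fact p.Prime] (n : ℕ) (hn : 1 ≤ n) :
    (∀ i : ℕ,
      ((Ring.jacobson (SymGrothendieck.RBar p n) ^ i).restrictScalars (ZMod p) =
        Submodule.span (ZMod p)
          {x | ∃ l : n.Partition, i ≤ SymGrothendieck.piP p l ∧ SymGrothendieck.phiBar p l = x}) ∧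
      LinearIndependent (ZMod p)
        (fun l : {l : n.Partition // i ≤ SymGrothendieck.piP p l} =>
          SymGrothendieck.phiBar p l.1)) ∧
    (Ring.jacobson (SymGrothendieck.RBar p n)).restrictScalars (ZMod p) =
      Submodule.span (ZMod p)
        {x | ∃ l : n.Partition,
          SymGrothendieck.IsPSingular p l ∧ SymGrothendieck.phiBar p l = x} := by
  refine ⟨fun i => ⟨SymGrothendieck.jacobson_pow_eq_levelSpan i, ?_⟩, ?_⟩
  · have h := (SymGrothendieck.phiBarBasis p n).linearIndependent.comp
      (fun l : {l : n.Partition // i ≤ SymGrothendieck.piP p l} => l.1) Subtype.val_injective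
    refine (linearIndependent_equiv' (Equiv.refl _) ?_).1 h
    funext l
    exact (SymGrothendieck.phiBarBasis_apply p l.1).symm
  · apply le_antisymm
    · intro u hu
      have h := SymGrothendieck.jacobson_le_levelSpan_one hu
      refine Submodule.span_mono ?_ h
      rintro _ ⟨l, hl, rfl⟩
      exact ⟨l, (SymGrothendieck.one_le_piP_iff_isPSingular l).1 hl, rfl⟩
    · rw [Submodule.span_le]
      rintro _ ⟨l, hl, rfl⟩
      exact SymGrothendieck.levelSpan_one_le_jacobson (SymGrothendieck.phiBar_mem_levelSpan l
        ((SymGrothendieck.one_le_piP_iff_isPSingular l).2 hl))
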